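/- Let $K$ be a field of characteristic zero; tensor products are over $K$, $'$ denotes the $K$-dual. **Dialgebras.** A dialgebra $D$ is a $K$-vector space with bilinear products $\dashv,\vdash$ such that $x\dashv(y\dashv z)=(x\dashv y)\dashv z=x\dashv(y\vdash z)$, $(x\vdash y)\dashv z=x\vdash(y\dashv z)$, $(x\dashv y)\vdash z=x\vdash(y\vdash z)=(x\vdash y)\vdash z$. Let $Y_n$ be the set of planar binary trees with $n$ vertices (leaves numbered $0,\dots,n$ from left to right), $d_i:Y_n\to Y_{n-1}$ the deletion of the $i$-th leaf, and $|\in Y_0$ the trivial tree. For $y\in Y_{n+1}$ put $\circ_0^y=\dashv$ if $y=|\vee y_1$ and $\vdash$ otherwise; $\circ_{n+1}^y=\vdash$ if $y=y_1\vee|$ and $\dashv$ otherwise; and for $1\le i\le n$, $\circ_i^y=\dashv$ if the $i$-th leaf is a left child (oriented like $\backslash$), and $\vdash$ if it is a right child. Let $HY^*(D,D)$ be the cohomology of $CY^n(D,D)=\mathrm{Hom}(K[Y_n]\otimes D^{\otimes n},D)$, with $$(\delta f)(y;a_1,\dots,a_{n+1})=a_1\circ_0^yf(d_0y;a_2,\dots,a_{n+1})+\sum_{i=1}^n(-1)^if(d_iy;a_1,\dots,a_i\circ_i^ya_{i+1},\dots,a_{n+1})+(-1)^{n+1}f(d_{n+1}y;a_1,\dots,a_n)\circ_{n+1}^ya_{n+1}.$$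 **Deformations.** Let $A$ be a commutative unital $K$-algebra with augmentation $\epsilon:A\to K$. A deformation of $D$ with base $A$ is an $A$-dialgebra structure on $A\otimes D$ for which $\epsilon\otimes\mathrm{id}:A\otimes D\to D$ is a dialgebra morphism. Two deformations with base $A$ are equivalent if there is an $A$-linear dialgebra isomorphism between them compatible with $\epsilon\otimes\mathrm{id}$. For a homomorphism $\phi:A\to A_1$ of augmented algebras, the push-out $\phi_*\lambda$ is the deformation with base $A_1$ whose products are the $A_1$-bilinear ones with $(1\otimes x)*_{\phi_*\lambda}(1\otimes y)=(\phi\otimes\mathrm{id})\big((1\otimes x)*_\lambda(1\otimes y)\big)$. **Harrison extensions.** Let $A$ act on a vector space $V$ through $\epsilon$. A Harrison 2-cocycle is a symmetric bilinear map $f:A\times A\to V$ with $a f(b,c)-f(ab,c)+f(a,bc)-c f(a,b)=0$; coboundaries are the maps $(a,b)\mapsto a\,h(b)-h(ab)+b\,h(a)$ with $h:A\to V$ linear; $H^2_{Harr}(A;V)$ is the quotient. A cocycle $f$ defines an extension $0\to V\to B\to A\to0$, where $B=A\oplus V$ with $(a,v)(b,w)=(ab,\,aw+bv+f(a,b))$,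 augmented through $A$. **Obstruction map.** Let $\lambda$ be a deformation of $D$ with base $A$, let $f$ be a Harrison cocycle with values in $K$, and let $0\to K\to B\to A\to0$ be its extension, with linear splitting $q:A\to B$, $q(a)=(a,0)$. Let $\{\,,\}_*$, $*\in\{\dashv,\vdash\}$, be the $B$-bilinear products on $B\otimes D$ with $\{1\otimes x,1\otimes y\}_*=(q\otimes\mathrm{id})\big((1\otimes x)*_\lambda(1\otimes y)\big)$. For $y\in Y_3$ the element $$\{1\otimes a,\{1\otimes b,1\otimes c\}_{\circ_2^y}\}_{\circ_0^y}-\{\{1\otimes a,1\otimes b\}_{\circ_1^y},1\otimes c\}_{\circ_3^y}$$ lies in $K\otimes D=D$. This defines a $3$-cocycle of $D$, and sending $[f]$ to its class gives a well-defined linear map $\mathbb O_\lambda:H^2_{Harr}(A;K)\to HY^3(D,D)$. **Construction.** Let $D$ be a dialgebra with $\dim HY^2(D,D)<\infty$. Let $C_1=K\oplus HY^2(D,D)'$, where $HY^2(D,D)'$ is an ideal of square zero, with augmentation the projection to $K$. Choose a linear map $\mu_0$ from $HY^2(D,D)$ to the $2$-cocycles which sends each class to a representative. Let $\eta_1$ be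 the deformation with base $C_1$ whose products on $C_1\otimes D=D\oplus\mathrm{Hom}(HY^2(D,D),D)$ are the $C_1$-bilinear ones with $x*x'=\big(x*x',\ \alpha\mapsto\mu_0(\alpha)(y_*;x,x')\big)$ for $x,x'\in D$, where $y_\dashv=|\vee(|\vee|)$ and $y_\vdash=(|\vee|)\vee|$. Given, for some $k\ge1$, the algebra $C_k$ and the deformation $\eta_k$ with base $C_k$, choose a linear map $\mu$ from $H^2_{Harr}(C_k;K)$ to the Harrison cocycles which sends each class to a representative. Let $0\to H^2_{Harr}(C_k;K)'\xrightarrow{\bar i_{k+1}}\overline C_{k+1}\to C_k\to0$ be the extension defined by the cocycle $(a,b)\mapsto(\alpha\mapsto\mu(\alpha)(a,b))$. Let $\omega_k=\mathbb O_{\eta_k}:H^2_{Harr}(C_k;K)\to HY^3(D,D)$, with dual $\omega_k'$, and put $C_{k+1}=\overline C_{k+1}/\bar i_{k+1}(\omega_k'(HY^3(D,D)'))$. Let $p_{k+1}:C_{k+1}\to C_k$ be induced by the projection of $\overline C_{k+1}$, and $i_{k+1}:(\ker\omega_k)'\cong\mathrm{coker}(\omega_k')\to C_{k+1}$ by $\bar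 i_{k+1}$; the augmentation of $C_{k+1}$ is that of $C_k$ composed with $p_{k+1}$. The construction is continued with $C_{k+1}$ and any deformation $\eta_{k+1}$ with base $C_{k+1}$ such that $(p_{k+1})_*\eta_{k+1}=\eta_k$. **Proposition.** Let $k\ge1$, let $(C_k,\eta_k)$ be obtained in this way with any choices made at the earlier stages, and let $C_{k+1}$ be formed with any $\mu$ as above. Then: 1. $C_{k+1}$ is a finite dimensional local algebra, and $$0\to(\ker\omega_k)'\xrightarrow{\,i_{k+1}\,}C_{k+1}\xrightarrow{\,p_{k+1}\,}C_k\to0$$ is exact. 2. The deformation $\eta_k$ extends to $C_{k+1}$: there is a deformation $\eta_{k+1}$ of $D$ with base $C_{k+1}$ such that $(p_{k+1})_*\eta_{k+1}=\eta_k$. 3. The extension is unique up to an isomorphism and an automorphism of the extension in 1: if $\eta',\eta''$ are deformations with base $C_{k+1}$ and $(p_{k+1})_*\eta'=(p_{k+1})_*\eta''=\eta_k$, there is a $K$-algebra automorphism $r$ of $C_{k+1}$ with $r\circ i_{k+1}=i_{k+1}$ and $p_{k+1}\circ r=p_{k+1}$ such that $r_*\eta'$ is equivalent to $\eta''$. 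-/

import Mathlib

set_option maxSynthPendingDepth 3

open scoped TensorProduct

universe u v w

noncomputable section

namespace DialgDef

/-! ## Planar binary trees -/

/-- The two dialgebra products: `left` is `⊣`, `right` is `⊢`. -/
inductive Side
  | left
  | right
  deriving DecidableEq

/-- Planar binary trees (the one-leaf tree `|` is `nil`, grafting is `node ()`). -/
abbrev PBT : Type := BinaryTree Unit

namespace PBT

/-- The tree obtained by deleting the `i`-th leaf, the leaves being numbered `0, 1, …` from left to
right. -/
def deleteLeaf : PBT → ℕ → PBT
  | .nil, _ => .nil
  | .node _ s t, i =>
    if i ≤ s.numNodes then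
      (if s = .nil then t else .node () (deleteLeaf s i) t)
    else
      (if t = .nil then s else .node () s (deleteLeaf t (i - (s.numNodes + 1))))

/-- The product attached to the `i`-th leaf by its orientation: `⊣` if the leaf is oriented like
`\`, i.e. it is a left child, and `⊢` if it is oriented like `/`, i.e. it is a right child. -/
def leafSide : PBT → ℕ → Side
  | .nil, _ => .left
  | .node _ s t, i =>
    if i ≤ s.numNodes then
      (if s = .nil then .left else leafSide s i)
    else
      (if t = .nil then .right else leafSide t (i - (s.numNodes + 1)))

/-- `∘_0`: it is `⊣` if the tree is of the form `| ∨ t`, and `⊢` otherwise. -/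
def firstSide : PBT → Side
  | .nil => .right
  | .node _ s _ => if s = .nil then .left else .right

/-- `∘_{n}` for an `n`-tree: it is `⊢` if the tree is of the form `s ∨ |`, and `⊣` otherwise. -/
def lastSide : PBT → Side
  | .nil => .left
  | .node _ _ t => if t = .nil then .right else .left

theorem numNodes_deleteLeaf :
    ∀ (t : PBT) (i : ℕ), i ≤ t.numNodes → (deleteLeaf t i).numNodes = t.numNodes - 1
  | .nil, _, _ => rfl
  | .node _ s t, i, h => by
    have hs := numNodes_deleteLeaf s i
    have ht := numNodes_deleteLeaf t (i - (s.numNodes + 1))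
    simp only [BinaryTree.numNodes] at h
    rw [deleteLeaf]
    have key : ∀ r : PBT, r ≠ .nil → 1 ≤ r.numNodes := by
      intro r hr
      cases r with
      | nil => exact absurd rfl hr
      | node _ a b => simp [BinaryTree.numNodes]
    split_ifs with h1 h2 h3
    · subst h2; simp [BinaryTree.numNodes]
    · have := key s h2
      simp only [BinaryTree.numNodes]
      have := hs h1
      omega
    · subst h3; simp [BinaryTree.numNodes]
    · have := key t h3
      simp only [BinaryTree.numNodes]
      have := ht (by omega)
      omega

end PBT

/-- `Y n` is the set of planar binary trees with `n` vertices. -/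
def Y (n : ℕ) : Type := {t : PBT // t.numNodes = n}

/-- The face map `d_i : Y_{n+1} → Y_n`, deleting the `i`-th leaf, `0 ≤ i ≤ n + 1`. -/
def face {n : ℕ} (i : Fin (n + 2)) (y : Y (n + 1)) : Y n :=
  ⟨PBT.deleteLeaf y.1 i, by
    rw [PBT.numNodes_deleteLeaf _ _ (by rw [y.2]; omega), y.2, Nat.add_sub_cancel]⟩

/-- The product `∘_i^y ∈ {⊣, ⊢}` for `y ∈ Y_{n+1}` and `0 ≤ i ≤ n + 1`. -/
def circ {n : ℕ} (i : Fin (n + 2)) (y : Y (n + 1)) : Side :=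
  if i = 0 then PBT.firstSide y.1
  else if i = Fin.last (n + 1) then PBT.lastSide y.1
  else PBT.leafSide y.1 i

/-- The label of a `2`-tree: `[21] = | ∨ (| ∨ |)` corresponds to `⊣` and `[12] = (| ∨ |) ∨ |`
to `⊢`. -/
def prodSide (y : Y 2) : Side := circ 0 y

theorem exists_of_numNodes_succ {n : ℕ} (t : PBT) (h : t.numNodes = n + 1) :
    ∃ a b : PBT, t = .node () a b ∧ a.numNodes + b.numNodes = n := by
  cases t with
  | nil => simp at h
  | node x a b => exact ⟨a, b, rfl, by simpa [BinaryTree.numNodes] using h⟩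

theorem eq_nil_of_numNodes (t : PBT) (h : t.numNodes = 0) : t = .nil := by
  cases t with
  | nil => rfl
  | node x a b => simp at h

theorem tree_one (t : PBT) (h : t.numNodes = 1) : t = .node () .nil .nil := by
  obtain ⟨a, b, rfl, hab⟩ := exists_of_numNodes_succ t h
  rw [eq_nil_of_numNodes a (by omega), eq_nil_of_numNodes b (by omega)]

/-- The two `2`-trees. -/
def trees2 : List PBT :=
  [.node () .nil (.node () .nil .nil), .node () (.node () .nil .nil) .nil]

/-- The five `3`-trees. -/
def trees3 : List PBT :=
  trees2.map (fun t => .node () .nil t) ++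
    [.node () (.node () .nil .nil) (.node () .nil .nil)] ++
    trees2.map (fun t => .node () t .nil)

/-- The fourteen `4`-trees. -/
def trees4 : List PBT :=
  trees3.map (fun t => .node () .nil t) ++
    trees2.map (fun t => .node () (.node () .nil .nil) t) ++
    trees2.map (fun t => .node () t (.node () .nil .nil)) ++
    trees3.map (fun t => .node () t .nil)

theorem mem_trees2 (t : PBT) (h : t.numNodes = 2) : t ∈ trees2 := by
  obtain ⟨a, b, rfl, hab⟩ := exists_of_numNodes_succ t h
  obtain h1 | h1 : a.numNodes = 0 ∨ a.numNodes = 1 := by omega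
  · rw [eq_nil_of_numNodes a h1, tree_one b (by omega)]; simp [trees2]
  · rw [tree_one a h1, eq_nil_of_numNodes b (by omega)]; simp [trees2]

theorem mem_trees3 (t : PBT) (h : t.numNodes = 3) : t ∈ trees3 := by
  obtain ⟨a, b, rfl, hab⟩ := exists_of_numNodes_succ t h
  obtain h1 | h1 | h1 : a.numNodes = 0 ∨ a.numNodes = 1 ∨ a.numNodes = 2 := by omega
  · rw [eq_nil_of_numNodes a h1, trees3]
    have := mem_trees2 b (by omega)
    exact List.mem_append_left _ (List.mem_append_left _ (List.mem_map_of_mem this))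
  · rw [tree_one a h1, tree_one b (by omega)]; simp [trees3]
  · rw [eq_nil_of_numNodes b (by omega), trees3]
    have := mem_trees2 a h1
    exact List.mem_append_right _ (List.mem_map_of_mem this)

theorem mem_trees4 (t : PBT) (h : t.numNodes = 4) : t ∈ trees4 := by
  obtain ⟨a, b, rfl, hab⟩ := exists_of_numNodes_succ t h
  obtain h1 | h1 | h1 | h1 : a.numNodes = 0 ∨ a.numNodes = 1 ∨ a.numNodes = 2 ∨
    a.numNodes = 3 := by omega
  · rw [eq_nil_of_numNodes a h1, trees4]
    have := mem_trees3 b (by omega)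
    exact List.mem_append_left _ (List.mem_append_left _
      (List.mem_append_left _ (List.mem_map_of_mem this)))
  · rw [tree_one a h1, trees4]
    have := mem_trees2 b (by omega)
    exact List.mem_append_left _ (List.mem_append_left _
      (List.mem_append_right _ (List.mem_map_of_mem this)))
  · rw [tree_one b (by omega), trees4]
    have := mem_trees2 a h1
    exact List.mem_append_left _ (List.mem_append_right _ (List.mem_map_of_mem this))
  · rw [eq_nil_of_numNodes b (by omega), trees4]
    have := mem_trees3 a h1
    exact List.mem_append_right _ (List.mem_map_of_mem this)

/-- The relations between the faces of a `3`-tree and its four products. -/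
theorem prodSide_face (y : Y 3) :
    prodSide (face 0 y) = circ 2 y ∧ prodSide (face 1 y) = circ 3 y ∧
      prodSide (face 2 y) = circ 0 y ∧ prodSide (face 3 y) = circ 1 y := by
  obtain ⟨t, ht⟩ := y
  have key : ∀ t ∈ trees3, ∀ h : t.numNodes = 3,
      prodSide (face 0 ⟨t, h⟩) = circ 2 (⟨t, h⟩ : Y 3) ∧
      prodSide (face 1 ⟨t, h⟩) = circ 3 (⟨t, h⟩ : Y 3) ∧
      prodSide (face 2 ⟨t, h⟩) = circ 0 (⟨t, h⟩ : Y 3) ∧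
      prodSide (face 3 ⟨t, h⟩) = circ 1 (⟨t, h⟩ : Y 3) := by decide
  exact key t (mem_trees3 t ht) ht

/-- The relations between the products of a `4`-tree and those of its faces. -/
theorem circ_face (y : Y 4) :
    (circ 0 y = circ 0 (face 3 y) ∧ circ 0 (face 0 y) = circ 2 (face 3 y) ∧
      circ 2 (face 0 y) = circ 3 y) ∧
    (circ 0 y = circ 0 (face 2 y) ∧ circ 3 (face 0 y) = circ 2 (face 2 y) ∧
      circ 1 (face 0 y) = circ 2 y) ∧
    (circ 0 (face 1 y) = circ 3 (face 3 y) ∧ circ 2 (face 1 y) = circ 3 y ∧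
      circ 1 y = circ 1 (face 3 y)) ∧
    (circ 3 (face 1 y) = circ 4 y ∧ circ 1 (face 1 y) = circ 3 (face 4 y) ∧
      circ 1 y = circ 1 (face 4 y)) ∧
    (circ 3 (face 2 y) = circ 4 y ∧ circ 1 (face 2 y) = circ 0 (face 4 y) ∧
      circ 2 y = circ 2 (face 4 y)) := by
  obtain ⟨t, ht⟩ := y
  have key : ∀ t ∈ trees4, ∀ h : t.numNodes = 4, ∀ y : Y 4, y = ⟨t, h⟩ →
    (circ 0 y = circ 0 (face 3 y) ∧ circ 0 (face 0 y) = circ 2 (face 3 y) ∧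
      circ 2 (face 0 y) = circ 3 y) ∧
    (circ 0 y = circ 0 (face 2 y) ∧ circ 3 (face 0 y) = circ 2 (face 2 y) ∧
      circ 1 (face 0 y) = circ 2 y) ∧
    (circ 0 (face 1 y) = circ 3 (face 3 y) ∧ circ 2 (face 1 y) = circ 3 y ∧
      circ 1 y = circ 1 (face 3 y)) ∧
    (circ 3 (face 1 y) = circ 4 y ∧ circ 1 (face 1 y) = circ 3 (face 4 y) ∧
      circ 1 y = circ 1 (face 4 y)) ∧
    (circ 3 (face 2 y) = circ 4 y ∧ circ 1 (face 2 y) = circ 0 (face 4 y) ∧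
      circ 2 y = circ 2 (face 4 y)) := by
    intro t ht h y hy
    subst hy
    revert h
    revert t
    decide
  exact key t (mem_trees4 t ht) ht _ rfl

/-! ## Dialgebras and their cohomology in degrees two and three -/

/-- A dialgebra structure on an `R`-module `M`: two `R`-bilinear products `⊣` (`left`) and `⊢`
(`right`) satisfying the five dialgebra axioms. -/
@[ext]
structure Dialgebra (R : Type*) (M : Type*) [CommRing R] [AddCommGroup M] [Module R M] where
  left : M →ₗ[R] M →ₗ[R] M
  right : M →ₗ[R] M →ₗ[R] M
  left_left : ∀ x y z, left x (left y z) = left (left x y) z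
  left_right : ∀ x y z, left (left x y) z = left x (right y z)
  inner_assoc : ∀ x y z, left (right x y) z = right x (left y z)
  right_left : ∀ x y z, right (left x y) z = right x (right y z)
  right_right : ∀ x y z, right x (right y z) = right (right x y) z

/-- The product of a dialgebra with a given label. -/
def Dialgebra.op {R : Type*} {M : Type*} [CommRing R] [AddCommGroup M] [Module R M]
    (S : Dialgebra R M) : Side → M →ₗ[R] M →ₗ[R] M
  | .left => S.left
  | .right => S.right

section Trilinear

variable {R : Type*} {M : Type*} [CommRing R] [AddCommGroup M] [Module R M]

/-- The trilinear map `(a, b, c) ↦ g a (f b c)`. -/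
def compRight (g f : M →ₗ[R] M →ₗ[R] M) : M →ₗ[R] M →ₗ[R] M →ₗ[R] M where
  toFun a := f.compr₂ (g a)
  map_add' a b := by ext; simp
  map_smul' r a := by ext; simp

/-- The trilinear map `(a, b, c) ↦ g (f a b) c`. -/
def compLeft (g f : M →ₗ[R] M →ₗ[R] M) : M →ₗ[R] M →ₗ[R] M →ₗ[R] M := f.compr₂ g

@[simp] theorem compRight_apply (g f : M →ₗ[R] M →ₗ[R] M) (a b c : M) :
    compRight g f a b c = g a (f b c) := rfl

@[simp] theorem compLeft_apply (g f : M →ₗ[R] M →ₗ[R] M) (a b c : M) :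
    compLeft g f a b c = g (f a b) c := rfl

/-- The defect of the dialgebra axiom belonging to the `3`-tree `y`, for two arbitrary bilinear
products: `(a, b, c) ↦ a ∘_0 (b ∘_2 c) - (a ∘_1 b) ∘_3 c`. -/
def axiomDefect (m : Side → M →ₗ[R] M →ₗ[R] M) (y : Y 3) : M →ₗ[R] M →ₗ[R] M →ₗ[R] M :=
  compRight (m (circ 0 y)) (m (circ 2 y)) - compLeft (m (circ 3 y)) (m (circ 1 y))

theorem axiomDefect_apply (m : Side → M →ₗ[R] M →ₗ[R] M) (y : Y 3) (a b c : M) :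
    axiomDefect m y a b c =
      m (circ 0 y) a (m (circ 2 y) b c) - m (circ 3 y) (m (circ 1 y) a b) c := rfl

theorem Dialgebra.axiomDefect_eq_zero (S : Dialgebra R M) (y : Y 3) : axiomDefect S.op y = 0 := by
  ext a b c
  rw [axiomDefect_apply]
  have key : ∀ t ∈ trees3, ∀ h : t.numNodes = 3,
      (circ 0 (⟨t, h⟩ : Y 3), circ 1 (⟨t, h⟩ : Y 3), circ 2 (⟨t, h⟩ : Y 3), circ 3 (⟨t, h⟩ : Y 3)) ∈
      [(Side.left, Side.left, Side.left, Side.left), (.left, .left, .right, .left),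
        (.right, .right, .left, .left), (.right, .left, .right, .right),
        (.right, .right, .right, .right)] := by decide
  have h := key y.1 (mem_trees3 y.1 y.2) y.2
  have hy : (⟨y.1, y.2⟩ : Y 3) = y := rfl
  simp only [hy, List.mem_cons, Prod.mk.injEq, List.not_mem_nil, or_false] at h
  rcases h with ⟨h0, h1, h2, h3⟩ | ⟨h0, h1, h2, h3⟩ | ⟨h0, h1, h2, h3⟩ | ⟨h0, h1, h2, h3⟩ |
    ⟨h0, h1, h2, h3⟩ <;> rw [h0, h1, h2, h3] <;> simp only [Dialgebra.op, LinearMap.zero_apply]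
  · rw [S.left_left, sub_self]
  · rw [S.left_right, sub_self]
  · rw [S.inner_assoc, sub_self]
  · rw [S.right_left, sub_self]
  · rw [S.right_right, sub_self]

/-- Two bilinear products all of whose axiom defects vanish form a dialgebra. -/
def Dialgebra.ofDefect (m : Side → M →ₗ[R] M →ₗ[R] M) (h : ∀ y, axiomDefect m y = 0) :
    Dialgebra R M where
  left := m .left
  right := m .right
  left_left a b c := by
    have := LinearMap.congr_fun (LinearMap.congr_fun (LinearMap.congr_fun
      (h ⟨.node () .nil (.node () .nil (.node () .nil .nil)), rfl⟩) a) b) c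
    exact sub_eq_zero.1 this
  left_right a b c := by
    have := LinearMap.congr_fun (LinearMap.congr_fun (LinearMap.congr_fun
      (h ⟨.node () .nil (.node () (.node () .nil .nil) .nil), rfl⟩) a) b) c
    exact (sub_eq_zero.1 this).symm
  inner_assoc a b c := by
    have := LinearMap.congr_fun (LinearMap.congr_fun (LinearMap.congr_fun
      (h ⟨.node () (.node () .nil .nil) (.node () .nil .nil), rfl⟩) a) b) c
    exact (sub_eq_zero.1 this).symm
  right_left a b c := by
    have := LinearMap.congr_fun (LinearMap.congr_fun (LinearMap.congr_fun
      (h ⟨.node () (.node () .nil (.node () .nil .nil)) .nil, rfl⟩) a) b) c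
    exact (sub_eq_zero.1 this).symm
  right_right a b c := by
    have := LinearMap.congr_fun (LinearMap.congr_fun (LinearMap.congr_fun
      (h ⟨.node () (.node () (.node () .nil .nil) .nil) .nil, rfl⟩) a) b) c
    exact sub_eq_zero.1 this

end Trilinear

section Quotient

variable {K : Type*} {V : Type w} [Field K] [AddCommGroup V] [Module K V]

/-- The quotient `Z / (B ∩ Z)` of two submodules of `V`: the cohomology with cocycles `Z` and
coboundaries `B`. -/
def Cohom (Z B : Submodule K V) : Type w := Z ⧸ B.submoduleOf Z

namespace Cohom

variable (Z B : Submodule K V)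

instance : AddCommGroup (Cohom Z B) := inferInstanceAs (AddCommGroup (Z ⧸ B.submoduleOf Z))

instance : Module K (Cohom Z B) := inferInstanceAs (Module K (Z ⧸ B.submoduleOf Z))

/-- The class of a cocycle. -/
def mk : Z →ₗ[K] Cohom Z B := (B.submoduleOf Z).mkQ

theorem mk_surjective : Function.Surjective (mk Z B) := (B.submoduleOf Z).mkQ_surjective

theorem mk_eq_zero_iff (z : Z) : mk Z B z = 0 ↔ z.1 ∈ B :=
  Submodule.Quotient.mk_eq_zero (B.submoduleOf Z)

variable {Z B}

/-- The linear map on cohomology induced by a linear map on cocycles vanishing on coboundaries. -/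
def lift {M : Type*} [AddCommGroup M] [Module K M] (g : Z →ₗ[K] M)
    (h : ∀ z : Z, z.1 ∈ B → g z = 0) : Cohom Z B →ₗ[K] M :=
  (B.submoduleOf Z).liftQ g h

theorem lift_mk {M : Type*} [AddCommGroup M] [Module K M] (g : Z →ₗ[K] M)
    (h : ∀ z : Z, z.1 ∈ B → g z = 0) (z : Z) : lift g h (mk Z B z) = g z := rfl

end Cohom

end Quotient

section Cohomology

variable {K : Type u} {D : Type v} [Field K] [AddCommGroup D] [Module K D]

variable (K D) in
/-- `CY^1(D, D) = Hom(K[Y_1] ⊗ D, D)`. -/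
abbrev CY1 : Type v := Y 1 → D →ₗ[K] D

variable (K D) in
/-- `CY^2(D, D) = Hom(K[Y_2] ⊗ D ⊗ D, D)`. -/
abbrev CY2 : Type v := Y 2 → D →ₗ[K] D →ₗ[K] D

variable (K D) in
/-- `CY^3(D, D) = Hom(K[Y_3] ⊗ D ⊗ D ⊗ D, D)`. -/
abbrev CY3 : Type v := Y 3 → D →ₗ[K] D →ₗ[K] D →ₗ[K] D

/-- The coboundary `δ : CY^1 → CY^2`. -/
def delta1 (S : Dialgebra K D) : CY1 K D →ₗ[K] CY2 K D where
  toFun f y := (S.op (circ 0 y)).compl₂ (f (face 0 y)) - (S.op (circ 1 y)).compr₂ (f (face 1 y)) +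
    (S.op (circ 2 y)).comp (f (face 2 y))
  map_add' f g := by
    funext y
    refine LinearMap.ext₂ fun a b => ?_
    simp
    abel
  map_smul' r f := by
    funext y
    refine LinearMap.ext₂ fun a b => ?_
    simp [smul_sub]

theorem delta1_apply (S : Dialgebra K D) (f : CY1 K D) (y : Y 2) (a b : D) :
    delta1 S f y a b = S.op (circ 0 y) a (f (face 0 y) b) - f (face 1 y) (S.op (circ 1 y) a b) +
      S.op (circ 2 y) (f (face 2 y) a) b := rfl

/-- The coboundary `δ : CY^2 → CY^3`. -/
def delta2 (S : Dialgebra K D) : CY2 K D →ₗ[K] CY3 K D where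
  toFun f y := compRight (S.op (circ 0 y)) (f (face 0 y)) -
    compLeft (f (face 1 y)) (S.op (circ 1 y)) + compRight (f (face 2 y)) (S.op (circ 2 y)) -
    compLeft (S.op (circ 3 y)) (f (face 3 y))
  map_add' f g := by
    funext y
    refine LinearMap.ext fun a => LinearMap.ext₂ fun b c => ?_
    simp
    abel
  map_smul' r f := by
    funext y
    refine LinearMap.ext fun a => LinearMap.ext₂ fun b c => ?_
    simp [smul_sub]

theorem delta2_apply (S : Dialgebra K D) (f : CY2 K D) (y : Y 3) (a b c : D) :
    delta2 S f y a b c = S.op (circ 0 y) a (f (face 0 y) b c) -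
      f (face 1 y) (S.op (circ 1 y) a b) c + f (face 2 y) a (S.op (circ 2 y) b c) -
      S.op (circ 3 y) (f (face 3 y) a b) c := rfl

/-- The coboundary `δ` on `CY^3`. Only its kernel is used, so its values are recorded as plain
functions of a `4`-tree and four arguments. -/
def delta3 (S : Dialgebra K D) : CY3 K D →ₗ[K] (Y 4 → D → D → D → D → D) where
  toFun f y a b c d := S.op (circ 0 y) a (f (face 0 y) b c d) -
    f (face 1 y) (S.op (circ 1 y) a b) c d + f (face 2 y) a (S.op (circ 2 y) b c) d -
    f (face 3 y) a b (S.op (circ 3 y) c d) + S.op (circ 4 y) (f (face 4 y) a b c) d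
  map_add' f g := by funext; simp; abel
  map_smul' r f := by funext; simp [smul_sub]

theorem delta3_apply (S : Dialgebra K D) (f : CY3 K D) (y : Y 4) (a b c d : D) :
    delta3 S f y a b c d = S.op (circ 0 y) a (f (face 0 y) b c d) -
      f (face 1 y) (S.op (circ 1 y) a b) c d + f (face 2 y) a (S.op (circ 2 y) b c) d -
      f (face 3 y) a b (S.op (circ 3 y) c d) + S.op (circ 4 y) (f (face 4 y) a b c) d := rfl

/-- The `2`-cocycles. -/
abbrev ZY2 (S : Dialgebra K D) : Submodule K (CY2 K D) := LinearMap.ker (delta2 S)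

/-- The `3`-cocycles. -/
abbrev ZY3 (S : Dialgebra K D) : Submodule K (CY3 K D) := LinearMap.ker (delta3 S)

/-- `HY^2(D, D)`. -/
abbrev HY2 (S : Dialgebra K D) : Type v := Cohom (ZY2 S) (LinearMap.range (delta1 S))

/-- `HY^3(D, D)`. -/
abbrev HY3 (S : Dialgebra K D) : Type v := Cohom (ZY3 S) (LinearMap.range (delta2 S))

/-- The class in `HY^2(D, D)` of a `2`-cocycle. -/
abbrev HY2.mk (S : Dialgebra K D) : ZY2 S →ₗ[K] HY2 S := Cohom.mk _ _

/-- The class in `HY^3(D, D)` of a `3`-cocycle. -/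
abbrev HY3.mk (S : Dialgebra K D) : ZY3 S →ₗ[K] HY3 S := Cohom.mk _ _

end Cohomology

/-! ## Deformations -/

section Deformations

variable {K : Type u} {D : Type v} [Field K] [AddCommGroup D] [Module K D]

/-- The map `h ⊗ id : A ⊗ D → K ⊗ D = D` for a linear form `h` on `A`. -/
def contract {A : Type w} [AddCommGroup A] [Module K A] (D : Type v) [AddCommGroup D] [Module K D]
    (h : A →ₗ[K] K) : A ⊗[K] D →ₗ[K] D :=
  (TensorProduct.lid K D).toLinearMap ∘ₗ h.rTensor D

@[simp] theorem contract_tmul {A : Type w} [AddCommGroup A] [Module K A]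
    (h : A →ₗ[K] K) (a : A) (x : D) : contract D h (a ⊗ₜ x) = h a • x := by
  simp [contract]

/-- The `A`-bilinear product on `A ⊗ D` which extends a `K`-bilinear map `D × D → A ⊗ D`. -/
def extendBilin {A : Type w} [CommRing A] [Algebra K A] (b : D →ₗ[K] D →ₗ[K] A ⊗[K] D) :
    A ⊗[K] D →ₗ[A] A ⊗[K] D →ₗ[A] A ⊗[K] D :=
  LinearMap.liftBaseChange A
    (((LinearMap.liftBaseChangeEquiv (M := D) (N := A ⊗[K] D) (R := K)
      A).toLinearMap.restrictScalars K) ∘ₗ b)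

theorem extendBilin_tmul {A : Type w} [CommRing A] [Algebra K A]
    (b : D →ₗ[K] D →ₗ[K] A ⊗[K] D) (s t : A) (x y : D) :
    extendBilin b (s ⊗ₜ x) (t ⊗ₜ y) = (s * t) • b x y := by
  simp [extendBilin, mul_smul]

/-- A deformation of the dialgebra `S` on `D` with base the commutative unital algebra `A`,
augmented by `ε`: an `A`-dialgebra structure on `A ⊗ D` such that the (automatically `A`-linear) map
`ε ⊗ id : A ⊗ D → K ⊗ D = D` is a morphism of dialgebras. -/
@[ext]
structure Deformation (S : Dialgebra K D) (A : Type w) [CommRing A] [Algebra K A] (ε : A →ₐ[K] K)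
    extends Dialgebra A (A ⊗[K] D) where
  aug_left : ∀ u v, contract D ε.toLinearMap (left u v) =
    S.left (contract D ε.toLinearMap u) (contract D ε.toLinearMap v)
  aug_right : ∀ u v, contract D ε.toLinearMap (right u v) =
    S.right (contract D ε.toLinearMap u) (contract D ε.toLinearMap v)

variable {S : Dialgebra K D}

/-- Two deformations with the same base are equivalent if there is an `A`-linear isomorphism of
dialgebras between them which is compatible with `ε ⊗ id`. -/
def Deformation.Equivalent {A : Type w} [CommRing A] [Algebra K A] {ε : A →ₐ[K] K}
    (η η' : Deformation S A ε) : Prop :=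
  ∃ ρ : A ⊗[K] D ≃ₗ[A] A ⊗[K] D,
    (∀ u v, ρ (η.left u v) = η'.left (ρ u) (ρ v)) ∧
    (∀ u v, ρ (η.right u v) = η'.right (ρ u) (ρ v)) ∧
    ∀ u, contract D ε.toLinearMap (ρ u) = contract D ε.toLinearMap u

section Pushout

variable {A : Type*} [CommRing A] [Algebra K A] {B : Type*} [CommRing B] [Algebra K B]

theorem tensor_smul_rTensor (φ : A →ₐ[K] B) (a : A) (u : A ⊗[K] D) :
    φ.toLinearMap.rTensor D (a • u) = φ a • φ.toLinearMap.rTensor D u := by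
  induction u using TensorProduct.induction_on with
  | zero => simp
  | tmul s x => simp [TensorProduct.smul_tmul']
  | add u v hu hv => simp [hu, hv]

/-- The push-out along `φ` of an `A`-bilinear product `m` on `A ⊗ D`: the `B`-bilinear product on
`B ⊗ D` with `(1 ⊗ x) * (1 ⊗ y) = (φ ⊗ id) (m (1 ⊗ x) (1 ⊗ y))`, that is,
`b ⊗ (a ⊗ x) * b' ⊗ (a' ⊗ y) = b b' ⊗ m (a ⊗ x) (a' ⊗ y)` on `B ⊗_A (A ⊗ D) = B ⊗ D`. -/
def pushBilin (φ : A →ₐ[K] B) (m : A ⊗[K] D →ₗ[A] A ⊗[K] D →ₗ[A] A ⊗[K] D) :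
    B ⊗[K] D →ₗ[B] B ⊗[K] D →ₗ[B] B ⊗[K] D :=
  extendBilin (LinearMap.mk₂ K (fun x y => φ.toLinearMap.rTensor D (m (1 ⊗ₜ x) (1 ⊗ₜ y)))
    (fun x x' y => by simp [TensorProduct.tmul_add])
    (fun r x y => by
      rw [TensorProduct.tmul_smul, LinearMap.map_smul_of_tower]; simp)
    (fun x y y' => by simp [TensorProduct.tmul_add])
    (fun r x y => by
      simp))

theorem pushBilin_tmul (φ : A →ₐ[K] B) (m : A ⊗[K] D →ₗ[A] A ⊗[K] D →ₗ[A] A ⊗[K] D)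
    (s t : B) (x y : D) :
    pushBilin φ m (s ⊗ₜ x) (t ⊗ₜ y) =
      (s * t) • φ.toLinearMap.rTensor D (m (1 ⊗ₜ x) (1 ⊗ₜ y)) := by
  rw [pushBilin, extendBilin_tmul]; rfl

/-- `φ ⊗ id` intertwines a product with its push-out. -/
theorem pushBilin_rTensor (φ : A →ₐ[K] B) (m : A ⊗[K] D →ₗ[A] A ⊗[K] D →ₗ[A] A ⊗[K] D)
    (u v : A ⊗[K] D) :
    pushBilin φ m (φ.toLinearMap.rTensor D u) (φ.toLinearMap.rTensor D v) =
      φ.toLinearMap.rTensor D (m u v) := by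
  induction u using TensorProduct.induction_on with
  | zero => simp
  | add u u' hu hu' => simp [hu, hu']
  | tmul s x =>
    induction v using TensorProduct.induction_on with
    | zero => simp
    | add v v' hv hv' => rw [map_add, map_add, hv, hv', map_add, map_add]
    | tmul t y =>
      have h1 : m (s ⊗ₜ x) (t ⊗ₜ y) = (s * t) • m (1 ⊗ₜ x) (1 ⊗ₜ y) := by
        have hs : (s ⊗ₜ[K] x : A ⊗[K] D) = s • (1 ⊗ₜ x) := by simp [TensorProduct.smul_tmul']
        have ht : (t ⊗ₜ[K] y : A ⊗[K] D) = t • (1 ⊗ₜ y) := by simp [TensorProduct.smul_tmul']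
        rw [hs, ht]; simp [mul_smul, smul_comm s t]
      rw [h1, tensor_smul_rTensor, LinearMap.rTensor_tmul, LinearMap.rTensor_tmul,
        pushBilin_tmul]
      simp

/-- A trilinear map on `B ⊗ D` which vanishes on the elements `1 ⊗ x` is zero. -/
theorem trilinear_ext {N : Type*} [AddCommGroup N] [Module B N]
    {F G : B ⊗[K] D →ₗ[B] B ⊗[K] D →ₗ[B] B ⊗[K] D →ₗ[B] N}
    (h : ∀ x y z : D, F (1 ⊗ₜ x) (1 ⊗ₜ y) (1 ⊗ₜ z) = G (1 ⊗ₜ x) (1 ⊗ₜ y) (1 ⊗ₜ z)) : F = G := by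
  have hs : ∀ (s : B) (x : D), (s ⊗ₜ[K] x : B ⊗[K] D) = s • (1 ⊗ₜ x) := by
    intro s x; simp [TensorProduct.smul_tmul']
  ext u v w
  induction u using TensorProduct.induction_on with
  | zero => simp
  | add u u' hu hu' => simp [hu, hu']
  | tmul s x =>
    induction v using TensorProduct.induction_on with
    | zero => simp
    | add v v' hv hv' => simp [hv, hv']
    | tmul t y =>
      induction w using TensorProduct.induction_on with
      | zero => simp
      | add w w' hw hw' => simp [hw, hw']
      | tmul r z => rw [hs s x, hs t y, hs r z]; simp [h]

theorem op_ofDefect {R : Type*} {M : Type*} [CommRing R] [AddCommGroup M] [Module R M]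
    (m : Side → M →ₗ[R] M →ₗ[R] M) (h : ∀ y, axiomDefect m y = 0) :
    (Dialgebra.ofDefect m h).op = m := by
  funext s; cases s <;> rfl

theorem contract_smul {A : Type*} [CommRing A] [Algebra K A] (ε : A →ₐ[K] K) (a : A)
    (u : A ⊗[K] D) :
    contract D ε.toLinearMap (a • u) = ε a • contract D ε.toLinearMap u := by
  induction u using TensorProduct.induction_on with
  | zero => simp
  | tmul s x => simp [TensorProduct.smul_tmul', mul_smul]
  | add u v hu hv => rw [smul_add, map_add, hu, hv, map_add, smul_add]

/-- To check compatibility of a product on `A ⊗ D` with `ε ⊗ id`, it is enough to consider the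
elements `1 ⊗ x`. -/
theorem contract_bilin {A : Type*} [CommRing A] [Algebra K A] (ε : A →ₐ[K] K)
    (m : A ⊗[K] D →ₗ[A] A ⊗[K] D →ₗ[A] A ⊗[K] D) (o : D →ₗ[K] D →ₗ[K] D)
    (h : ∀ x y, contract D ε.toLinearMap (m (1 ⊗ₜ x) (1 ⊗ₜ y)) = o x y) (u v : A ⊗[K] D) :
    contract D ε.toLinearMap (m u v) =
      o (contract D ε.toLinearMap u) (contract D ε.toLinearMap v) := by
  have hs : ∀ (s : A) (x : D), (s ⊗ₜ[K] x : A ⊗[K] D) = s • (1 ⊗ₜ x) := by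
    intro s x; simp [TensorProduct.smul_tmul']
  induction u using TensorProduct.induction_on with
  | zero => simp
  | add u u' hu hu' => simp [hu, hu']
  | tmul s x =>
    induction v using TensorProduct.induction_on with
    | zero => simp
    | add v v' hv hv' => simp [hv, hv']
    | tmul t y =>
      rw [hs s x, hs t y]
      simp only [map_smul, LinearMap.smul_apply, contract_smul, h]
      simp

/-- Build a deformation from the products labelled by `⊣` and `⊢`. -/
def Deformation.ofOp {A : Type*} [CommRing A] [Algebra K A] {ε : A →ₐ[K] K}
    (m : Side → A ⊗[K] D →ₗ[A] A ⊗[K] D →ₗ[A] A ⊗[K] D) (h : ∀ y, axiomDefect m y = 0)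
    (h' : ∀ s x y, contract D ε.toLinearMap (m s (1 ⊗ₜ x) (1 ⊗ₜ y)) = S.op s x y) :
    Deformation S A ε where
  toDialgebra := Dialgebra.ofDefect m h
  aug_left := contract_bilin ε _ _ (h' .left)
  aug_right := contract_bilin ε _ _ (h' .right)

theorem Deformation.aug_op {A : Type*} [CommRing A] [Algebra K A] {ε : A →ₐ[K] K}
    (η : Deformation S A ε) (s : Side) (u v : A ⊗[K] D) :
    contract D ε.toLinearMap (η.op s u v) =
      S.op s (contract D ε.toLinearMap u) (contract D ε.toLinearMap v) := by
  cases s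
  · exact η.aug_left u v
  · exact η.aug_right u v

theorem contract_rTensor {A : Type*} [CommRing A] [Algebra K A] {B : Type*} [CommRing B]
    [Algebra K B] {ε : A →ₐ[K] K} {ε' : B →ₐ[K] K} (φ : A →ₐ[K] B) (hφ : ∀ a, ε' (φ a) = ε a)
    (u : A ⊗[K] D) :
    contract D ε'.toLinearMap (φ.toLinearMap.rTensor D u) = contract D ε.toLinearMap u := by
  induction u using TensorProduct.induction_on with
  | zero => simp
  | tmul s x => simp [hφ]
  | add u v hu hv => simp [hu, hv]

/-- The push-out `φ_* η` of a deformation along a homomorphism of augmented algebras. -/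
def Deformation.pushout {ε : A →ₐ[K] K} {ε' : B →ₐ[K] K} (φ : A →ₐ[K] B)
    (hφ : ∀ a, ε' (φ a) = ε a) (η : Deformation S A ε) : Deformation S B ε' :=
  Deformation.ofOp (fun s => pushBilin φ (η.op s))
    (fun y => trilinear_ext (fun x x' x'' => by
      have e : ∀ z : D, (1 ⊗ₜ[K] z : B ⊗[K] D) = φ.toLinearMap.rTensor D (1 ⊗ₜ z) := by simp
      have h := LinearMap.congr_fun (LinearMap.congr_fun (LinearMap.congr_fun
        (η.toDialgebra.axiomDefect_eq_zero y) (1 ⊗ₜ x)) (1 ⊗ₜ x')) (1 ⊗ₜ x'')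
      rw [axiomDefect_apply] at h ⊢
      rw [e x, e x', e x'']
      simp only [pushBilin_rTensor, ← map_sub, h]
      simp))
    (fun s x y => by
      rw [pushBilin_tmul, mul_one, one_smul, contract_rTensor φ hφ, η.aug_op]
      simp)

theorem Deformation.pushout_op {ε : A →ₐ[K] K} {ε' : B →ₐ[K] K} (φ : A →ₐ[K] B)
    (hφ : ∀ a, ε' (φ a) = ε a) (η : Deformation S A ε) :
    (η.pushout φ hφ).op = fun s => pushBilin φ (η.op s) := by
  funext s; cases s <;> rfl

end Pushout

end Deformations

/-! ## Harrison cohomology in degree two and extensions -/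

section Harrison

variable {K : Type u} [Field K] {A : Type w} [CommRing A] [Algebra K A]

/-- The Harrison `2`-cocycles of `A` with coefficients in a vector space `V`, on which `A` acts
through the augmentation `ε`: the symmetric bilinear maps `f : A × A → V` with
`a f(b, c) - f(ab, c) + f(a, bc) - f(a, b) c = 0`. -/
def harrZ2 (ε : A →ₐ[K] K) (V : Type*) [AddCommGroup V] [Module K V] :
    Submodule K (A →ₗ[K] A →ₗ[K] V) where
  carrier := {f | (∀ a b, f a b = f b a) ∧
    ∀ a b c, ε a • f b c - f (a * b) c + f a (b * c) - ε c • f a b = 0}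
  zero_mem' := by simp
  add_mem' {f g} hf hg := by
    refine ⟨fun a b => by simp [hf.1 a b, hg.1 a b], fun a b c => ?_⟩
    have := congrArg₂ (· + ·) (hf.2 a b c) (hg.2 a b c)
    simp only [add_zero] at this
    rw [← this]
    simp only [LinearMap.add_apply, smul_add]
    abel
  smul_mem' r f hf := by
    refine ⟨fun a b => by simp [hf.1 a b], fun a b c => ?_⟩
    have := congrArg (r • ·) (hf.2 a b c)
    simp only [smul_zero] at this
    rw [← this]
    simp only [LinearMap.smul_apply, smul_sub, smul_add, smul_comm r]

/-- The coboundary `(δ h)(a, b) = a h(b) - h(ab) + h(a) b` of a `1`-cochain `h : A → V`. -/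
def harrD1 (ε : A →ₐ[K] K) (V : Type*) [AddCommGroup V] [Module K V] :
    (A →ₗ[K] V) →ₗ[K] (A →ₗ[K] A →ₗ[K] V) where
  toFun h := LinearMap.mk₂ K (fun a b => ε a • h b - h (a * b) + ε b • h a)
    (fun a a' b => by simp only [map_add, add_mul, add_smul, smul_add]; abel)
    (fun r a b => by
      simp only [map_smul, smul_mul_assoc, smul_sub, smul_add, smul_assoc, smul_comm r])
    (fun a b b' => by simp only [map_add, mul_add, add_smul, smul_add]; abel)
    (fun r a b => by
      simp only [map_smul, mul_smul_comm, smul_sub, smul_add, smul_assoc, smul_comm r])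
  map_add' h h' := by
    refine LinearMap.ext₂ fun a b => ?_
    simp only [LinearMap.mk₂_apply, LinearMap.add_apply, smul_add]; abel
  map_smul' r h := by
    refine LinearMap.ext₂ fun a b => ?_
    simp only [LinearMap.mk₂_apply, LinearMap.smul_apply, smul_sub, smul_add, smul_comm r,
      RingHom.id_apply]

theorem harrD1_apply (ε : A →ₐ[K] K) {V : Type*} [AddCommGroup V] [Module K V] (h : A →ₗ[K] V)
    (a b : A) : harrD1 ε V h a b = ε a • h b - h (a * b) + ε b • h a := rfl

/-- `H^2_Harr(A; K)`, where `A` acts on `K` through `ε`. -/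
abbrev HarrH2 (ε : A →ₐ[K] K) : Type (max w u) :=
  Cohom (harrZ2 ε K) (LinearMap.range (harrD1 ε K))

/-- The class in `H^2_Harr(A; K)` of a cocycle. -/
abbrev HarrH2.mk (ε : A →ₐ[K] K) : harrZ2 ε K →ₗ[K] HarrH2 ε := Cohom.mk _ _

variable {ε : A →ₐ[K] K} {V : Type*} [AddCommGroup V] [Module K V]

/-- The extension `B` of `A` by `V` belonging to a Harrison cocycle `f`: the vector space `A ⊕ V`
with the product `(a, v) (b, w) = (a b, a w + b v + f(a, b))`. -/
@[ext]
structure HarrExt (f : harrZ2 ε V) where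
  base : A
  fib : V

namespace HarrExt

variable {f : harrZ2 ε V}

theorem cocycle_one (f : harrZ2 ε V) (a : A) : f.1 1 a = ε a • f.1 1 1 := by
  have h := f.2.2 1 1 a
  simp only [map_one, one_smul, one_mul, sub_self, zero_add] at h
  exact sub_eq_zero.1 h

theorem cocycle_assoc (f : harrZ2 ε V) (a b c : A) :
    f.1 (a * b) c + ε c • f.1 a b = ε a • f.1 b c + f.1 a (b * c) := by
  rw [← sub_eq_zero, ← neg_eq_zero, ← f.2.2 a b c]; abel

instance : CommRing (HarrExt f) where
  zero := ⟨0, 0⟩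
  add x y := ⟨x.base + y.base, x.fib + y.fib⟩
  neg x := ⟨-x.base, -x.fib⟩
  sub x y := ⟨x.base - y.base, x.fib - y.fib⟩
  nsmul n x := ⟨n • x.base, n • x.fib⟩
  zsmul n x := ⟨n • x.base, n • x.fib⟩
  mul x y := ⟨x.base * y.base, ε x.base • y.fib + ε y.base • x.fib + f.1 x.base y.base⟩
  one := ⟨1, -f.1 1 1⟩
  add_assoc x y z := HarrExt.ext (add_assoc _ _ _) (add_assoc _ _ _)
  zero_add x := HarrExt.ext (zero_add _) (zero_add _)
  add_zero x := HarrExt.ext (add_zero _) (add_zero _)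
  add_comm x y := HarrExt.ext (add_comm _ _) (add_comm _ _)
  neg_add_cancel x := HarrExt.ext (neg_add_cancel _) (neg_add_cancel _)
  sub_eq_add_neg x y := HarrExt.ext (sub_eq_add_neg _ _) (sub_eq_add_neg _ _)
  nsmul_zero x := HarrExt.ext (zero_nsmul _) (zero_nsmul _)
  nsmul_succ n x := HarrExt.ext (succ_nsmul _ _) (succ_nsmul _ _)
  zsmul_zero' x := HarrExt.ext (zero_zsmul _) (zero_zsmul _)
  zsmul_succ' n x := HarrExt.ext (SubNegMonoid.zsmul_succ' _ _) (SubNegMonoid.zsmul_succ' _ _)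
  zsmul_neg' n x := HarrExt.ext (SubNegMonoid.zsmul_neg' _ _) (SubNegMonoid.zsmul_neg' _ _)
  mul_comm x y := HarrExt.ext (mul_comm _ _) (by
    change ε x.base • y.fib + ε y.base • x.fib + f.1 x.base y.base =
      ε y.base • x.fib + ε x.base • y.fib + f.1 y.base x.base
    rw [f.2.1 x.base y.base]; abel)
  zero_mul x := HarrExt.ext (zero_mul _) (by
    change ε 0 • x.fib + ε x.base • (0 : V) + f.1 0 x.base = 0
    simp)
  mul_zero x := HarrExt.ext (mul_zero _) (by
    change ε x.base • (0 : V) + ε 0 • x.fib + f.1 x.base 0 = 0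
    simp)
  one_mul x := HarrExt.ext (one_mul _) (by
    change ε 1 • x.fib + ε x.base • (-f.1 1 1) + f.1 1 x.base = x.fib
    rw [cocycle_one f x.base, map_one ε, one_smul, smul_neg]; abel)
  mul_one x := HarrExt.ext (mul_one _) (by
    change ε x.base • (-f.1 1 1) + ε 1 • x.fib + f.1 x.base 1 = x.fib
    rw [f.2.1 x.base 1, cocycle_one f x.base, map_one ε, one_smul, smul_neg]; abel)
  left_distrib x y z := HarrExt.ext (mul_add _ _ _) (by
    change ε x.base • (y.fib + z.fib) + ε (y.base + z.base) • x.fib + f.1 x.base (y.base + z.base) =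
      (ε x.base • y.fib + ε y.base • x.fib + f.1 x.base y.base) +
        (ε x.base • z.fib + ε z.base • x.fib + f.1 x.base z.base)
    simp only [map_add, smul_add, add_smul]; abel)
  right_distrib x y z := HarrExt.ext (add_mul _ _ _) (by
    change ε (x.base + y.base) • z.fib + ε z.base • (x.fib + y.fib) + f.1 (x.base + y.base) z.base =
      (ε x.base • z.fib + ε z.base • x.fib + f.1 x.base z.base) +
        (ε y.base • z.fib + ε z.base • y.fib + f.1 y.base z.base)
    simp only [map_add, smul_add, add_smul, LinearMap.add_apply]; abel)
  mul_assoc x y z := HarrExt.ext (mul_assoc _ _ _) (by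
    change ε (x.base * y.base) • z.fib +
        ε z.base • (ε x.base • y.fib + ε y.base • x.fib + f.1 x.base y.base) +
          f.1 (x.base * y.base) z.base =
      ε x.base • (ε y.base • z.fib + ε z.base • y.fib + f.1 y.base z.base) +
        ε (y.base * z.base) • x.fib + f.1 x.base (y.base * z.base)
    have h := cocycle_assoc f x.base y.base z.base
    simp only [map_mul, smul_add]
    calc _ = (ε x.base * ε y.base) • z.fib + ε z.base • ε x.base • y.fib +
            ε z.base • ε y.base • x.fib +
            (f.1 (x.base * y.base) z.base + ε z.base • f.1 x.base y.base) := by abel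
      _ = _ := by
        rw [h, smul_smul, smul_smul, smul_smul, smul_smul, mul_comm (ε z.base) (ε x.base),
          mul_comm (ε z.base) (ε y.base)]
        abel)

@[simp] theorem zero_base : (0 : HarrExt f).base = 0 := rfl
@[simp] theorem zero_fib : (0 : HarrExt f).fib = 0 := rfl
@[simp] theorem add_base (x y : HarrExt f) : (x + y).base = x.base + y.base := rfl
@[simp] theorem add_fib (x y : HarrExt f) : (x + y).fib = x.fib + y.fib := rfl
@[simp] theorem one_base : (1 : HarrExt f).base = 1 := rfl
@[simp] theorem one_fib : (1 : HarrExt f).fib = -f.1 1 1 := rfl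
@[simp] theorem mul_base (x y : HarrExt f) : (x * y).base = x.base * y.base := rfl
@[simp] theorem mul_fib (x y : HarrExt f) :
    (x * y).fib = ε x.base • y.fib + ε y.base • x.fib + f.1 x.base y.base := rfl

instance : Algebra K (HarrExt f) where
  smul r x := ⟨r • x.base, r • x.fib⟩
  algebraMap :=
    { toFun := fun r => ⟨r • 1, r • (-f.1 1 1)⟩
      map_one' := HarrExt.ext (one_smul _ _) (one_smul _ _)
      map_zero' := HarrExt.ext (zero_smul _ _) (zero_smul _ _)
      map_add' := fun r s => HarrExt.ext (add_smul _ _ _) (add_smul _ _ _)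
      map_mul' := fun r s => by
        ext
        · simp [mul_smul, smul_comm s r]
        · simp only [mul_fib, map_smul, map_one, LinearMap.smul_apply, smul_eq_mul, mul_one,
            mul_smul, smul_neg, smul_comm s r]
          abel }
  commutes' r x := mul_comm _ _
  smul_def' r x := by
    ext
    · change r • x.base = r • 1 * x.base
      simp
    · change r • x.fib = ε (r • 1) • x.fib + ε x.base • r • (-f.1 1 1) + f.1 (r • 1) x.base
      simp only [map_smul, map_one, LinearMap.smul_apply, smul_eq_mul, mul_one, smul_neg,
        cocycle_one f x.base, smul_comm r]
      abel

@[simp] theorem smul_base (r : K) (x : HarrExt f) : (r • x).base = r • x.base := rfl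
@[simp] theorem smul_fib (r : K) (x : HarrExt f) : (r • x).fib = r • x.fib := rfl

/-- The projection `p : B → A`. -/
def proj (f : harrZ2 ε V) : HarrExt f →ₐ[K] A :=
  AlgHom.ofLinearMap
    { toFun := HarrExt.base, map_add' := fun _ _ => rfl, map_smul' := fun _ _ => rfl } rfl
    (fun _ _ => rfl)

/-- The inclusion `i : V → B`. -/
def incl (f : harrZ2 ε V) : V →ₗ[K] HarrExt f where
  toFun v := ⟨0, v⟩
  map_add' v w := by ext <;> simp
  map_smul' r v := by ext <;> simp

/-- The linear splitting `q : A → B`, `a ↦ (a, 0)`. -/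
def split (f : harrZ2 ε V) : A →ₗ[K] HarrExt f where
  toFun a := ⟨a, 0⟩
  map_add' v w := by ext <;> simp
  map_smul' r v := by ext <;> simp

/-- The second component `B → V`, the inverse of `i` on `ker p`. -/
def fibMap (f : harrZ2 ε V) : HarrExt f →ₗ[K] V where
  toFun := HarrExt.fib
  map_add' _ _ := rfl
  map_smul' _ _ := rfl

/-- The augmentation of `B` induced by the one of `A`. -/
def aug (f : harrZ2 ε V) : HarrExt f →ₐ[K] K := ε.comp (proj f)

@[simp] theorem proj_apply (x : HarrExt f) : proj f x = x.base := rfl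
@[simp] theorem aug_apply (x : HarrExt f) : aug f x = ε x.base := rfl
@[simp] theorem fibMap_apply (x : HarrExt f) : fibMap f x = x.fib := rfl
@[simp] theorem incl_base (v : V) : (incl f v).base = 0 := rfl
@[simp] theorem incl_fib (v : V) : (incl f v).fib = v := rfl
@[simp] theorem split_base (a : A) : (split f a).base = a := rfl
@[simp] theorem split_fib (a : A) : (split f a).fib = 0 := rfl

theorem mul_incl (x : HarrExt f) (v : V) : x * incl f v = incl f (ε x.base • v) := by
  ext <;> simp

theorem incl_mul_incl (v w : V) : incl f v * incl f w = 0 := by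
  rw [mul_incl, incl_base, map_zero, zero_smul, map_zero]

theorem aug_incl (v : V) : aug f (incl f v) = 0 := by
  rw [aug_apply, incl_base, map_zero]

end HarrExt

/-- The cocycle `f_A : (a, b) ↦ (φ ↦ μ(φ)(a, b))` with values in `H^2_Harr(A; K)'`, for a linear map
`μ` which chooses a cocycle in every class. -/
def univCocycle (μ : HarrH2 ε →ₗ[K] harrZ2 ε K) : harrZ2 ε (Module.Dual K (HarrH2 ε)) :=
  ⟨LinearMap.mk₂ K
    (fun a b => (LinearMap.applyₗ b ∘ₗ LinearMap.applyₗ a) ∘ₗ (harrZ2 ε K).subtype ∘ₗ μ)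
    (fun a a' b => by ext; simp) (fun r a b => by ext; simp)
    (fun a a' b => by ext; simp) (fun r a b => by ext; simp),
    fun a b => LinearMap.ext fun φ => (μ φ).2.1 a b,
    fun a b c => LinearMap.ext fun φ => (μ φ).2.2 a b c⟩

theorem univCocycle_apply (μ : HarrH2 ε →ₗ[K] harrZ2 ε K) (a b : A) (φ : HarrH2 ε) :
    (univCocycle μ).1 a b φ = (μ φ).1 a b := rfl

end Harrison

/-! ## Obstructions -/

section Obstruction

variable {K : Type u} {D : Type v} [Field K] [AddCommGroup D] [Module K D]

/-- The `K`-trilinear map `(x, y, z) ↦ π (F (1 ⊗ x) (1 ⊗ y) (1 ⊗ z))` on `D`. -/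
def restrictTri {B : Type*} [CommRing B] [Algebra K B] (π : B ⊗[K] D →ₗ[K] D)
    (F : B ⊗[K] D →ₗ[B] B ⊗[K] D →ₗ[B] B ⊗[K] D →ₗ[B] B ⊗[K] D) :
    D →ₗ[K] D →ₗ[K] D →ₗ[K] D where
  toFun x := LinearMap.mk₂ K (fun y z => π (F (1 ⊗ₜ x) (1 ⊗ₜ y) (1 ⊗ₜ z)))
    (fun y y' z => by simp [TensorProduct.tmul_add])
    (fun r y z => by
      rw [TensorProduct.tmul_smul, LinearMap.map_smul_of_tower, LinearMap.smul_apply, map_smul])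
    (fun y z z' => by simp [TensorProduct.tmul_add])
    (fun r y z => by rw [TensorProduct.tmul_smul, LinearMap.map_smul_of_tower, map_smul])
  map_add' x x' := by
    refine LinearMap.ext₂ fun y z => ?_
    simp [TensorProduct.tmul_add]
  map_smul' r x := by
    refine LinearMap.ext₂ fun y z => ?_
    simp only [LinearMap.mk₂_apply, LinearMap.smul_apply, RingHom.id_apply]
    rw [TensorProduct.tmul_smul, LinearMap.map_smul_of_tower, LinearMap.smul_apply,
      LinearMap.smul_apply, map_smul]

variable {S : Dialgebra K D} {A : Type w} [CommRing A] [Algebra K A] {ε : A →ₐ[K] K}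

/-- The `B`-bilinear lift to `B ⊗ D` of an `A`-bilinear product `m` on `A ⊗ D`, given on the elements
`1 ⊗ x` by `{1 ⊗ x, 1 ⊗ y} = (q ⊗ id) (m (1 ⊗ x) (1 ⊗ y))`; here `B` is the extension of `A` by `K`
belonging to `f` and `q` is the linear splitting of `B → A`. -/
def liftBilin (f : harrZ2 ε K) (m : A ⊗[K] D →ₗ[A] A ⊗[K] D →ₗ[A] A ⊗[K] D) :
    HarrExt f ⊗[K] D →ₗ[HarrExt f] HarrExt f ⊗[K] D →ₗ[HarrExt f] HarrExt f ⊗[K] D :=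
  extendBilin (LinearMap.mk₂ K
    (fun x y => (HarrExt.split f).rTensor D (m (1 ⊗ₜ x) (1 ⊗ₜ y)))
    (fun x x' y => by simp [TensorProduct.tmul_add])
    (fun r x y => by
      rw [TensorProduct.tmul_smul, LinearMap.map_smul_of_tower, LinearMap.smul_apply, map_smul])
    (fun x y y' => by simp [TensorProduct.tmul_add])
    (fun r x y => by rw [TensorProduct.tmul_smul, LinearMap.map_smul_of_tower, map_smul]))

theorem liftBilin_tmul (f : harrZ2 ε K) (m : A ⊗[K] D →ₗ[A] A ⊗[K] D →ₗ[A] A ⊗[K] D)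
    (s t : HarrExt f) (x y : D) :
    liftBilin f m (s ⊗ₜ x) (t ⊗ₜ y) =
      (s * t) • (HarrExt.split f).rTensor D (m (1 ⊗ₜ x) (1 ⊗ₜ y)) := by
  rw [liftBilin, extendBilin_tmul]; rfl

/-- The lifted products `{ , }_⊣` and `{ , }_⊢` on `B ⊗ D`. -/
abbrev liftOp (η : Deformation S A ε) (f : harrZ2 ε K) (s : Side) :
    HarrExt f ⊗[K] D →ₗ[HarrExt f] HarrExt f ⊗[K] D →ₗ[HarrExt f] HarrExt f ⊗[K] D :=
  liftBilin f (η.op s)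

/-- The obstruction cochain: the defects of the dialgebra axioms for the lifted products take values
in `ker (p ⊗ id) = D`, and this is the induced cochain `K[Y_3] ⊗ D ⊗ D ⊗ D → D`. -/
def obstrCochain (η : Deformation S A ε) (f : harrZ2 ε K) : CY3 K D :=
  fun y => restrictTri (contract D (HarrExt.fibMap f)) (axiomDefect (liftOp η f) y)

theorem obstrCochain_apply (η : Deformation S A ε) (f : harrZ2 ε K) (y : Y 3) (a b c : D) :
    obstrCochain η f y a b c = contract D (HarrExt.fibMap f)
      (axiomDefect (liftOp η f) y (1 ⊗ₜ a) (1 ⊗ₜ b) (1 ⊗ₜ c)) := rfl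

/-! ### Linearity in the Harrison cocycle, and coboundaries -/

/-- The linear map `a ⊗ d ↦ (f(a, -) ⊗ id) (g d)`. -/
def nest (f : A →ₗ[K] A →ₗ[K] K) (g : D →ₗ[K] A ⊗[K] D) : A ⊗[K] D →ₗ[K] D :=
  TensorProduct.lift (LinearMap.mk₂ K (fun a d => contract D (f a) (g d))
    (fun a a' d => by simp [contract, LinearMap.rTensor_add])
    (fun r a d => by simp [contract, LinearMap.rTensor_smul])
    (fun a d d' => by simp) (fun r a d => by simp))

@[simp] theorem nest_tmul (f : A →ₗ[K] A →ₗ[K] K) (g : D →ₗ[K] A ⊗[K] D) (a : A) (d : D) :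
    nest f g (a ⊗ₜ d) = contract D (f a) (g d) := rfl

theorem nest_add (f f' : A →ₗ[K] A →ₗ[K] K) (g : D →ₗ[K] A ⊗[K] D) (u : A ⊗[K] D) :
    nest (f + f') g u = nest f g u + nest f' g u := by
  induction u using TensorProduct.induction_on with
  | zero => simp
  | tmul a d => simp [contract, LinearMap.rTensor_add]
  | add u v hu hv => simp only [map_add, hu, hv]; abel

theorem nest_smul (r : K) (f : A →ₗ[K] A →ₗ[K] K) (g : D →ₗ[K] A ⊗[K] D) (u : A ⊗[K] D) :
    nest (r • f) g u = r • nest f g u := by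
  induction u using TensorProduct.induction_on with
  | zero => simp
  | tmul a d => simp [contract, LinearMap.rTensor_smul]
  | add u v hu hv => simp only [map_add, hu, hv, smul_add]

/-- `d ↦ m (1 ⊗ x) (1 ⊗ d)`. -/
def leftMul (m : A ⊗[K] D →ₗ[A] A ⊗[K] D →ₗ[A] A ⊗[K] D) (x : D) : D →ₗ[K] A ⊗[K] D :=
  (m (1 ⊗ₜ x)).restrictScalars K ∘ₗ TensorProduct.mk K A D 1

/-- `d ↦ m (1 ⊗ d) (1 ⊗ x)`. -/
def rightMul (m : A ⊗[K] D →ₗ[A] A ⊗[K] D →ₗ[A] A ⊗[K] D) (x : D) : D →ₗ[K] A ⊗[K] D :=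
  (m.flip (1 ⊗ₜ x)).restrictScalars K ∘ₗ TensorProduct.mk K A D 1

@[simp] theorem leftMul_apply (m : A ⊗[K] D →ₗ[A] A ⊗[K] D →ₗ[A] A ⊗[K] D) (x d : D) :
    leftMul m x d = m (1 ⊗ₜ x) (1 ⊗ₜ d) := rfl

@[simp] theorem rightMul_apply (m : A ⊗[K] D →ₗ[A] A ⊗[K] D →ₗ[A] A ⊗[K] D) (x d : D) :
    rightMul m x d = m (1 ⊗ₜ d) (1 ⊗ₜ x) := rfl

theorem tmul_eq_smul {B : Type*} [CommRing B] [Algebra K B] (s : B) (x : D) :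
    (s ⊗ₜ[K] x : B ⊗[K] D) = s • (1 ⊗ₜ x) := by simp [TensorProduct.smul_tmul']

theorem contract_split_smul (f : harrZ2 ε K) (a : A) (w : A ⊗[K] D) :
    contract D (HarrExt.fibMap f) (HarrExt.split f a • (HarrExt.split f).rTensor D w) =
      contract D (f.1 a) w := by
  induction w using TensorProduct.induction_on with
  | zero => simp
  | tmul b e => simp [TensorProduct.smul_tmul']
  | add u v hu hv => simp only [map_add, smul_add, hu, hv]

theorem contract_liftBilin_left (f : harrZ2 ε K) (m : A ⊗[K] D →ₗ[A] A ⊗[K] D →ₗ[A] A ⊗[K] D)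
    (x : D) (u : A ⊗[K] D) :
    contract D (HarrExt.fibMap f) (liftBilin f m (1 ⊗ₜ x) ((HarrExt.split f).rTensor D u)) =
      nest f.1 (leftMul m x) u := by
  induction u using TensorProduct.induction_on with
  | zero => simp
  | tmul a d =>
    rw [LinearMap.rTensor_tmul, liftBilin_tmul, one_mul, contract_split_smul, nest_tmul,
      leftMul_apply]
  | add u v hu hv => simp only [map_add, hu, hv]

theorem contract_liftBilin_right (f : harrZ2 ε K) (m : A ⊗[K] D →ₗ[A] A ⊗[K] D →ₗ[A] A ⊗[K] D)
    (x : D) (u : A ⊗[K] D) :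
    contract D (HarrExt.fibMap f) (liftBilin f m ((HarrExt.split f).rTensor D u) (1 ⊗ₜ x)) =
      nest f.1 (rightMul m x) u := by
  induction u using TensorProduct.induction_on with
  | zero => simp
  | tmul a d =>
    rw [LinearMap.rTensor_tmul, liftBilin_tmul, mul_one, contract_split_smul, nest_tmul,
      rightMul_apply]
  | add u v hu hv => simp only [map_add, LinearMap.add_apply, hu, hv]

theorem obstrCochain_eq_nest (η : Deformation S A ε) (f : harrZ2 ε K) (y : Y 3) (a b c : D) :
    obstrCochain η f y a b c =
      nest f.1 (leftMul (η.op (circ 0 y)) a) (η.op (circ 2 y) (1 ⊗ₜ b) (1 ⊗ₜ c)) -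
      nest f.1 (rightMul (η.op (circ 3 y)) c) (η.op (circ 1 y) (1 ⊗ₜ a) (1 ⊗ₜ b)) := by
  rw [obstrCochain_apply, axiomDefect_apply, map_sub, ← contract_liftBilin_left,
    ← contract_liftBilin_right, liftBilin_tmul f _ 1 1 b c, liftBilin_tmul f _ 1 1 a b, one_mul,
    one_smul, one_smul]

/-- The obstruction cochain as a linear map in the Harrison cocycle. -/
def obstrLin (η : Deformation S A ε) : harrZ2 ε K →ₗ[K] CY3 K D where
  toFun f := obstrCochain η f
  map_add' f g := by
    funext y
    refine LinearMap.ext fun a => LinearMap.ext₂ fun b c => ?_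
    simp only [Pi.add_apply, LinearMap.add_apply, obstrCochain_eq_nest, Submodule.coe_add, nest_add]
    abel
  map_smul' r f := by
    funext y
    refine LinearMap.ext fun a => LinearMap.ext₂ fun b c => ?_
    simp only [Pi.smul_apply, LinearMap.smul_apply, obstrCochain_eq_nest, Submodule.coe_smul,
      nest_smul, smul_sub, RingHom.id_apply]

theorem nest_coboundary_left (h : A →ₗ[K] K) (η : Deformation S A ε) (s : Side)
    (x : D) (u : A ⊗[K] D) :
    nest (harrD1 ε K h) (leftMul (η.op s) x) u =
      contract D h (η.op s (1 ⊗ₜ x) (1 ⊗ₜ contract D ε.toLinearMap u)) -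
        contract D h (η.op s (1 ⊗ₜ x) u) + S.op s x (contract D h u) := by
  induction u using TensorProduct.induction_on with
  | zero => simp
  | add u v hu hv =>
    simp only [map_add, TensorProduct.tmul_add, hu, hv]; abel
  | tmul a d =>
    have key : ∀ w : A ⊗[K] D, contract D (harrD1 ε K h a) w =
        ε a • contract D h w - contract D h (a • w) + h a • contract D ε.toLinearMap w := by
      intro w
      induction w using TensorProduct.induction_on with
      | zero => simp
      | tmul b e =>
        simp only [contract_tmul, harrD1_apply, TensorProduct.smul_tmul', smul_eq_mul, add_smul,
          sub_smul, mul_smul, AlgHom.toLinearMap_apply]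
        rw [smul_comm (ε b) (h a)]
      | add u v hu hv => simp only [map_add, smul_add, hu, hv]; abel
    rw [nest_tmul, key, leftMul_apply, η.aug_op, contract_tmul, contract_tmul, contract_tmul,
      contract_tmul, tmul_eq_smul a d]
    rw [(η.op s (1 ⊗ₜ x)).map_smul a (1 ⊗ₜ d)]
    simp only [map_one, one_smul, AlgHom.toLinearMap_apply]
    rw [TensorProduct.tmul_smul, (η.op s (1 ⊗ₜ x)).map_smul_of_tower (ε a),
      (contract D h).map_smul, (S.op s x).map_smul]

theorem nest_coboundary_right (h : A →ₗ[K] K) (η : Deformation S A ε) (s : Side)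
    (x : D) (u : A ⊗[K] D) :
    nest (harrD1 ε K h) (rightMul (η.op s) x) u =
      contract D h (η.op s (1 ⊗ₜ contract D ε.toLinearMap u) (1 ⊗ₜ x)) -
        contract D h (η.op s u (1 ⊗ₜ x)) + S.op s (contract D h u) x := by
  induction u using TensorProduct.induction_on with
  | zero => simp
  | add u v hu hv =>
    simp only [map_add, TensorProduct.tmul_add, LinearMap.add_apply, hu, hv]; abel
  | tmul a d =>
    have key : ∀ w : A ⊗[K] D, contract D (harrD1 ε K h a) w =
        ε a • contract D h w - contract D h (a • w) + h a • contract D ε.toLinearMap w := by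
      intro w
      induction w using TensorProduct.induction_on with
      | zero => simp
      | tmul b e =>
        simp only [contract_tmul, harrD1_apply, TensorProduct.smul_tmul', smul_eq_mul, add_smul,
          sub_smul, mul_smul, AlgHom.toLinearMap_apply]
        rw [smul_comm (ε b) (h a)]
      | add u v hu hv => simp only [map_add, smul_add, hu, hv]; abel
    rw [nest_tmul, key, rightMul_apply, η.aug_op, contract_tmul, contract_tmul, contract_tmul,
      contract_tmul, tmul_eq_smul a d]
    rw [(η.op s).map_smul a (1 ⊗ₜ d), LinearMap.smul_apply]
    simp only [map_one, one_smul, AlgHom.toLinearMap_apply]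
    rw [TensorProduct.tmul_smul, (η.op s).map_smul_of_tower (ε a), LinearMap.smul_apply,
      (contract D h).map_smul, (S.op s).map_smul, LinearMap.smul_apply]

/-- The `2`-cochain `(y; a, b) ↦ (h ⊗ id) ((1 ⊗ a) * (1 ⊗ b))` of a linear form `h` on `A`. -/
def defCochain (η : Deformation S A ε) (h : A →ₗ[K] K) : CY2 K D :=
  fun y => LinearMap.mk₂ K (fun a b => contract D h (η.op (prodSide y) (1 ⊗ₜ a) (1 ⊗ₜ b)))
    (fun x x' y => by simp [TensorProduct.tmul_add])
    (fun r x y => by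
      rw [TensorProduct.tmul_smul, LinearMap.map_smul_of_tower, LinearMap.smul_apply, map_smul])
    (fun x y y' => by simp [TensorProduct.tmul_add])
    (fun r x y => by rw [TensorProduct.tmul_smul, LinearMap.map_smul_of_tower, map_smul])

theorem defCochain_apply (η : Deformation S A ε) (h : A →ₗ[K] K) (y : Y 2) (a b : D) :
    defCochain η h y a b = contract D h (η.op (prodSide y) (1 ⊗ₜ a) (1 ⊗ₜ b)) := rfl

theorem obstrCochain_coboundary (η : Deformation S A ε) (f : harrZ2 ε K) (h : A →ₗ[K] K)
    (hf : harrD1 ε K h = f.1) : obstrCochain η f = delta2 S (defCochain η h) := by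
  funext y
  refine LinearMap.ext fun a => LinearMap.ext₂ fun b c => ?_
  obtain ⟨h0, h1, h2, h3⟩ := prodSide_face y
  have hz := LinearMap.congr_fun (LinearMap.congr_fun (LinearMap.congr_fun
    (η.toDialgebra.axiomDefect_eq_zero y) (1 ⊗ₜ a)) (1 ⊗ₜ b)) (1 ⊗ₜ c)
  rw [axiomDefect_apply] at hz
  have hz' := sub_eq_zero.1 hz
  rw [obstrCochain_eq_nest, ← hf, nest_coboundary_left, nest_coboundary_right, delta2_apply,
    defCochain_apply, defCochain_apply, defCochain_apply, defCochain_apply, h0, h1, h2, h3, hz',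
    η.aug_op, η.aug_op]
  simp only [contract_tmul, AlgHom.toLinearMap_apply, map_one, one_smul]
  abel

/-! ### The obstruction cochain is a cocycle -/

section Cocycle

variable (η : Deformation S A ε) (f : harrZ2 ε K)

theorem proj_split (u : A ⊗[K] D) :
    (HarrExt.proj f).toLinearMap.rTensor D ((HarrExt.split f).rTensor D u) = u := by
  induction u using TensorProduct.induction_on with
  | zero => simp
  | tmul a d => simp
  | add u v hu hv => simp only [map_add, hu, hv]

theorem proj_liftOp (s : Side) (u v : HarrExt f ⊗[K] D) :
    (HarrExt.proj f).toLinearMap.rTensor D (liftOp η f s u v) =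
      η.op s ((HarrExt.proj f).toLinearMap.rTensor D u)
        ((HarrExt.proj f).toLinearMap.rTensor D v) := by
  induction u using TensorProduct.induction_on with
  | zero => simp
  | add u u' hu hu' => simp only [map_add, LinearMap.add_apply, hu, hu']
  | tmul s' x =>
    induction v using TensorProduct.induction_on with
    | zero => simp
    | add v v' hv hv' => simp only [map_add, hv, hv']
    | tmul t y =>
      rw [liftOp, liftBilin_tmul, tensor_smul_rTensor, proj_split, LinearMap.rTensor_tmul,
        LinearMap.rTensor_tmul, tmul_eq_smul ((HarrExt.proj f).toLinearMap s') x,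
        tmul_eq_smul ((HarrExt.proj f).toLinearMap t) y]
      simp only [map_smul, LinearMap.smul_apply, map_mul, mul_smul, AlgHom.toLinearMap_apply]
      rw [smul_comm]

theorem aug_liftOp (s : Side) (u v : HarrExt f ⊗[K] D) :
    contract D (HarrExt.aug f).toLinearMap (liftOp η f s u v) =
      S.op s (contract D (HarrExt.aug f).toLinearMap u)
        (contract D (HarrExt.aug f).toLinearMap v) := by
  have h : ∀ w : HarrExt f ⊗[K] D, contract D (HarrExt.aug f).toLinearMap w =
      contract D ε.toLinearMap ((HarrExt.proj f).toLinearMap.rTensor D w) := fun w =>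
    (contract_rTensor (HarrExt.proj f) (fun _ => rfl) w).symm
  rw [h, h, h, proj_liftOp, η.aug_op]

/-- An element of `ker (p ⊗ id)` lies in the image of `i ⊗ id`. -/
theorem eq_incl_smul (w : HarrExt f ⊗[K] D) :
    w = (HarrExt.split f).rTensor D ((HarrExt.proj f).toLinearMap.rTensor D w) +
      HarrExt.incl f 1 • (1 ⊗ₜ contract D (HarrExt.fibMap f) w) := by
  induction w using TensorProduct.induction_on with
  | zero => simp
  | add u v hu hv =>
    conv_lhs => rw [hu, hv]
    simp only [map_add, TensorProduct.tmul_add, smul_add]; abel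
  | tmul b x =>
    rw [contract_tmul, TensorProduct.tmul_smul, TensorProduct.smul_tmul',
      TensorProduct.smul_tmul', LinearMap.rTensor_tmul, LinearMap.rTensor_tmul,
      ← TensorProduct.add_tmul]
    congr 1
    ext <;> simp

theorem incl_smul (w : HarrExt f ⊗[K] D) :
    HarrExt.incl f 1 • w = HarrExt.incl f 1 • (1 ⊗ₜ contract D (HarrExt.aug f).toLinearMap w) := by
  induction w using TensorProduct.induction_on with
  | zero => simp
  | add u v hu hv => simp only [map_add, TensorProduct.tmul_add, smul_add, hu, hv]
  | tmul b x =>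
    rw [contract_tmul, TensorProduct.smul_tmul', TensorProduct.tmul_smul, smul_comm,
      TensorProduct.smul_tmul', TensorProduct.smul_tmul']
    congr 1
    rw [smul_eq_mul, smul_eq_mul, mul_comm, HarrExt.mul_incl]
    ext <;> simp

theorem contract_incl_smul (d : D) :
    contract D (HarrExt.fibMap f) (HarrExt.incl f 1 • (1 ⊗ₜ d : HarrExt f ⊗[K] D)) = d := by
  rw [TensorProduct.smul_tmul', contract_tmul, smul_eq_mul, mul_one]
  simp

/-- The defects of the lifted products, in terms of the obstruction cochain. -/
theorem axiomDefect_liftOp (y : Y 3) (u v w : HarrExt f ⊗[K] D) :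
    axiomDefect (liftOp η f) y u v w = HarrExt.incl f 1 •
      (1 ⊗ₜ obstrCochain η f y (contract D (HarrExt.aug f).toLinearMap u)
        (contract D (HarrExt.aug f).toLinearMap v) (contract D (HarrExt.aug f).toLinearMap w)) := by
  have base : ∀ a b c : D, axiomDefect (liftOp η f) y (1 ⊗ₜ a) (1 ⊗ₜ b) (1 ⊗ₜ c) =
      HarrExt.incl f 1 • (1 ⊗ₜ obstrCochain η f y a b c) := by
    intro a b c
    have h0 : (HarrExt.proj f).toLinearMap.rTensor D
        (axiomDefect (liftOp η f) y (1 ⊗ₜ a) (1 ⊗ₜ b) (1 ⊗ₜ c)) = 0 := by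
      rw [axiomDefect_apply, map_sub, proj_liftOp, proj_liftOp, proj_liftOp, proj_liftOp]
      have hz := LinearMap.congr_fun (LinearMap.congr_fun (LinearMap.congr_fun
        (η.toDialgebra.axiomDefect_eq_zero y) (1 ⊗ₜ a)) (1 ⊗ₜ b)) (1 ⊗ₜ c)
      simpa [axiomDefect_apply] using hz
    rw [eq_incl_smul f (axiomDefect (liftOp η f) y (1 ⊗ₜ a) (1 ⊗ₜ b) (1 ⊗ₜ c)), h0, map_zero,
      zero_add, obstrCochain_apply]
  have sm : ∀ (b : HarrExt f) (d : D),
      b • HarrExt.incl f 1 • (1 ⊗ₜ d : HarrExt f ⊗[K] D) =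
        HarrExt.incl f 1 • (1 ⊗ₜ (HarrExt.aug f b • d)) := by
    intro b d
    rw [smul_comm, incl_smul, contract_smul, contract_tmul]
    simp
  induction u using TensorProduct.induction_on with
  | zero => simp
  | add u u' hu hu' =>
    simp only [map_add, LinearMap.add_apply, hu, hu', TensorProduct.tmul_add, smul_add]
  | tmul r x =>
    induction v using TensorProduct.induction_on with
    | zero => simp
    | add v v' hv hv' =>
      simp only [map_add, LinearMap.add_apply, hv, hv', TensorProduct.tmul_add, smul_add]
    | tmul s y' =>
      induction w using TensorProduct.induction_on with
      | zero => simp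
      | add w w' hw hw' => simp only [map_add, hw, hw', TensorProduct.tmul_add, smul_add]
      | tmul t z =>
        rw [tmul_eq_smul r x, tmul_eq_smul s y', tmul_eq_smul t z]
        simp only [map_smul, LinearMap.smul_apply, base, sm, contract_smul, contract_tmul,
          AlgHom.toLinearMap_apply, map_one, one_smul]

theorem fib_liftOp_right (s : Side) (a : D) (d : D) :
    contract D (HarrExt.fibMap f)
      (liftOp η f s (1 ⊗ₜ a) (HarrExt.incl f 1 • (1 ⊗ₜ d))) = S.op s a d := by
  rw [map_smul, incl_smul, contract_incl_smul, aug_liftOp]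
  simp

theorem fib_liftOp_left (s : Side) (a : D) (d : D) :
    contract D (HarrExt.fibMap f)
      (liftOp η f s (HarrExt.incl f 1 • (1 ⊗ₜ d)) (1 ⊗ₜ a)) = S.op s d a := by
  rw [map_smul, LinearMap.smul_apply, incl_smul, contract_incl_smul, aug_liftOp]
  simp

theorem fib_axiomDefect (y : Y 3) (u v w : HarrExt f ⊗[K] D) :
    contract D (HarrExt.fibMap f) (axiomDefect (liftOp η f) y u v w) =
      obstrCochain η f y (contract D (HarrExt.aug f).toLinearMap u)
        (contract D (HarrExt.aug f).toLinearMap v) (contract D (HarrExt.aug f).toLinearMap w) := by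
  rw [axiomDefect_liftOp, contract_incl_smul]

theorem obstrCochain_mem (η : Deformation S A ε) (f : harrZ2 ε K) :
    obstrCochain η f ∈ ZY3 S := by
  rw [LinearMap.mem_ker]
  funext y a b c d
  have e1 : ∀ x : D, contract D (HarrExt.aug f).toLinearMap (1 ⊗ₜ x) = x := by intro x; simp
  have t0 : S.op (circ 0 y) a (obstrCochain η f (face 0 y) b c d) =
      contract D (HarrExt.fibMap f) (liftOp η f (circ 0 y) (1 ⊗ₜ a)
        (axiomDefect (liftOp η f) (face 0 y) (1 ⊗ₜ b) (1 ⊗ₜ c) (1 ⊗ₜ d))) := by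
    rw [axiomDefect_liftOp, fib_liftOp_right, e1, e1, e1]
  have t1 : obstrCochain η f (face 1 y) (S.op (circ 1 y) a b) c d =
      contract D (HarrExt.fibMap f) (axiomDefect (liftOp η f) (face 1 y)
        (liftOp η f (circ 1 y) (1 ⊗ₜ a) (1 ⊗ₜ b)) (1 ⊗ₜ c) (1 ⊗ₜ d)) := by
    rw [fib_axiomDefect, aug_liftOp, e1, e1, e1, e1]
  have t2 : obstrCochain η f (face 2 y) a (S.op (circ 2 y) b c) d =
      contract D (HarrExt.fibMap f) (axiomDefect (liftOp η f) (face 2 y) (1 ⊗ₜ a)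
        (liftOp η f (circ 2 y) (1 ⊗ₜ b) (1 ⊗ₜ c)) (1 ⊗ₜ d)) := by
    rw [fib_axiomDefect, aug_liftOp, e1, e1, e1, e1]
  have t3 : obstrCochain η f (face 3 y) a b (S.op (circ 3 y) c d) =
      contract D (HarrExt.fibMap f) (axiomDefect (liftOp η f) (face 3 y) (1 ⊗ₜ a) (1 ⊗ₜ b)
        (liftOp η f (circ 3 y) (1 ⊗ₜ c) (1 ⊗ₜ d))) := by
    rw [fib_axiomDefect, aug_liftOp, e1, e1, e1, e1]
  have t4 : S.op (circ 4 y) (obstrCochain η f (face 4 y) a b c) d =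
      contract D (HarrExt.fibMap f) (liftOp η f (circ 4 y)
        (axiomDefect (liftOp η f) (face 4 y) (1 ⊗ₜ a) (1 ⊗ₜ b) (1 ⊗ₜ c)) (1 ⊗ₜ d)) := by
    rw [axiomDefect_liftOp, fib_liftOp_left, e1, e1, e1]
  rw [delta3_apply, t0, t1, t2, t3, t4, ← map_sub, ← map_add, ← map_sub, ← map_add]
  obtain ⟨⟨p1, p2, p3⟩, ⟨q1, q2, q3⟩, ⟨r1, r2, r3⟩, ⟨s1, s2, s3⟩, ⟨u1, u2, u3⟩⟩ := circ_face y
  simp only [axiomDefect_apply, map_sub, LinearMap.sub_apply]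
  rw [← p1, ← p2, p3, ← q1, ← q2, q3, r1, r2, ← r3, s1, s2, ← s3, u1, u2, ← u3]
  simp only [Pi.zero_apply]
  abel_nf
  exact map_zero _

end Cocycle

/-- The obstruction map `𝕆_η : H^2_Harr(A; K) → HY^3(D, D)` of a deformation `η` with base `A`. -/
def obstruction (η : Deformation S A ε) : HarrH2 ε →ₗ[K] HY3 S :=
  Cohom.lift (HY3.mk S ∘ₗ (obstrLin η).codRestrict (ZY3 S) (obstrCochain_mem η)) (by
    rintro f ⟨h, hh⟩
    rw [LinearMap.comp_apply, Cohom.mk_eq_zero_iff]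
    exact ⟨defCochain η h, (obstrCochain_coboundary η f h hh).symm⟩)

theorem obstruction_mk (η : Deformation S A ε) (f : harrZ2 ε K) :
    obstruction η (HarrH2.mk ε f) = HY3.mk S ⟨obstrCochain η f, obstrCochain_mem η f⟩ := rfl

end Obstruction

/-! ## The universal infinitesimal deformation -/

section Infinitesimal

variable {K : Type u} {D : Type v} [Field K] [AddCommGroup D] [Module K D]

/-- The `2`-tree of a product: `[21]` for `⊣` and `[12]` for `⊢`. -/
def sideTree : Side → Y 2
  | .left => ⟨.node () .nil (.node () .nil .nil), rfl⟩
  | .right => ⟨.node () (.node () .nil .nil) .nil, rfl⟩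

theorem sideTree_prodSide (y : Y 2) : sideTree (prodSide y) = y := by
  have key : ∀ t ∈ trees2, ∀ h : t.numNodes = 2,
      (sideTree (prodSide (⟨t, h⟩ : Y 2))).1 = t := by decide
  exact Subtype.ext (key y.1 (mem_trees2 y.1 y.2) y.2)

/-- The linear map `α ↦ μ(α)(y; x, x')` on `HY^2(D, D)`. -/
def evalCocycle {S : Dialgebra K D} (μ : HY2 S →ₗ[K] ZY2 S) (y : Y 2) :
    D →ₗ[K] D →ₗ[K] HY2 S →ₗ[K] D :=
  LinearMap.mk₂ K
    (fun x x' => LinearMap.applyₗ x' ∘ₗ LinearMap.applyₗ x ∘ₗ LinearMap.proj y ∘ₗ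
      (ZY2 S).subtype ∘ₗ μ)
    (fun x x' z => LinearMap.ext fun α => by simp)
    (fun r x z => LinearMap.ext fun α => by simp)
    (fun x z z' => LinearMap.ext fun α => by simp)
    (fun r x z => LinearMap.ext fun α => by simp)

theorem evalCocycle_apply {S : Dialgebra K D} (μ : HY2 S →ₗ[K] ZY2 S) (y : Y 2) (x x' : D)
    (α : HY2 S) : evalCocycle μ y x x' α = (μ α).1 y x x' := rfl

/-- The cocycle condition for `μ(α)`, `α ∈ HY^2(D, D)`. -/
theorem evalCocycle_assoc {S : Dialgebra K D} (μ : HY2 S →ₗ[K] ZY2 S) (y : Y 3) (a b c : D) :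
    evalCocycle μ (sideTree (circ 0 y)) a (S.op (circ 2 y) b c) +
        S.op (circ 0 y) a ∘ₗ evalCocycle μ (sideTree (circ 2 y)) b c =
      evalCocycle μ (sideTree (circ 3 y)) (S.op (circ 1 y) a b) c +
        (S.op (circ 3 y)).flip c ∘ₗ evalCocycle μ (sideTree (circ 1 y)) a b := by
  obtain ⟨h0, h1, h2, h3⟩ := prodSide_face y
  refine LinearMap.ext fun α => ?_
  have hα := LinearMap.congr_fun (LinearMap.congr_fun (LinearMap.congr_fun
    (congrFun (LinearMap.mem_ker.1 (μ α).2) y) a) b) c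
  rw [delta2_apply] at hα
  simp only [LinearMap.add_apply, LinearMap.comp_apply, evalCocycle_apply, LinearMap.flip_apply]
  have e0 := sideTree_prodSide (face 0 y)
  have e1 := sideTree_prodSide (face 1 y)
  have e2 := sideTree_prodSide (face 2 y)
  have e3 := sideTree_prodSide (face 3 y)
  rw [h0] at e0
  rw [h1] at e1
  rw [h2] at e2
  rw [h3] at e3
  rw [e0, e1, e2, e3, ← sub_eq_zero]
  refine Eq.trans ?_ hα
  abel

section SquareZero

variable {H : Type*} [AddCommGroup H] [Module K H] {B : Type*} [CommRing B] [Algebra K B]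
  (j : Module.Dual K H →ₗ[K] B) [FiniteDimensional K H]

variable (D) in
/-- For `j : H' → B`, the map `j ⊗ id : Hom(H, D) = H' ⊗ D → B ⊗ D`. -/
def homIncl : (H →ₗ[K] D) →ₗ[K] B ⊗[K] D :=
  j.rTensor D ∘ₗ (dualTensorHomEquiv K H D).symm.toLinearMap

theorem homIncl_dualTensorHom (ξ : Module.Dual K H) (d : D) :
    homIncl D j (dualTensorHom K H D (ξ ⊗ₜ d)) = j ξ ⊗ₜ d := by
  have h : (dualTensorHomEquiv K H D).symm (dualTensorHom K H D (ξ ⊗ₜ d)) = ξ ⊗ₜ d :=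
    (dualTensorHomEquiv K H D).symm_apply_apply (ξ ⊗ₜ d)
  rw [homIncl, LinearMap.comp_apply, LinearEquiv.coe_coe, h, LinearMap.rTensor_tmul]

/-- Induction principle for `Hom(H, D) = H' ⊗ D`. -/
theorem hom_induction {P : (H →ₗ[K] D) → Prop} (h0 : P 0)
    (h1 : ∀ (ξ : Module.Dual K H) (d : D), P (dualTensorHom K H D (ξ ⊗ₜ d)))
    (h2 : ∀ w w', P w → P w' → P (w + w')) (w : H →ₗ[K] D) : P w := by
  have h : ∀ t : Module.Dual K H ⊗[K] D, P (dualTensorHom K H D t) := by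
    intro t
    induction t using TensorProduct.induction_on with
    | zero => rw [map_zero]; exact h0
    | tmul ξ d => exact h1 ξ d
    | add t t' ht ht' => rw [map_add]; exact h2 _ _ ht ht'
  obtain ⟨t, rfl⟩ := (dualTensorHomEquiv K H D).surjective w
  exact h t

theorem incl_smul_homIncl (hj : ∀ ξ ξ', j ξ * j ξ' = 0) (ξ : Module.Dual K H) (w : H →ₗ[K] D) :
    j ξ • homIncl D j w = 0 := by
  induction w using hom_induction with
  | h0 => rw [map_zero, smul_zero]
  | h1 ξ' d =>
    rw [homIncl_dualTensorHom, TensorProduct.smul_tmul', smul_eq_mul, hj,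
      TensorProduct.zero_tmul]
  | h2 w w' hw hw' => rw [map_add, smul_add, hw, hw', add_zero]

theorem contract_homIncl {ε : B →ₐ[K] K} (hε : ∀ ξ, ε (j ξ) = 0) (w : H →ₗ[K] D) :
    contract D ε.toLinearMap (homIncl D j w) = 0 := by
  induction w using hom_induction with
  | h0 => rw [map_zero, map_zero]
  | h1 ξ' d => rw [homIncl_dualTensorHom, contract_tmul, AlgHom.toLinearMap_apply, hε, zero_smul]
  | h2 w w' hw hw' => rw [map_add, map_add, hw, hw', add_zero]

variable (S : Dialgebra K D) (T : Side → D →ₗ[K] D →ₗ[K] H →ₗ[K] D)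

/-- The `B`-bilinear products on `B ⊗ D` with `x * x' = (x * x') + T(x, x')` for `x, x' ∈ D`, where
`Hom(H, D) = H' ⊗ D` is mapped to `B ⊗ D` by `j ⊗ id`. -/
def sqZeroOp (s : Side) :
    B ⊗[K] D →ₗ[B] B ⊗[K] D →ₗ[B] B ⊗[K] D :=
  extendBilin ((S.op s).compr₂ (TensorProduct.mk K B D 1) +
    (T s).compr₂ (homIncl D j))

theorem sqZeroOp_one (s : Side) (x x' : D) :
    sqZeroOp j S T s (1 ⊗ₜ x) (1 ⊗ₜ x') = 1 ⊗ₜ S.op s x x' + homIncl D j (T s x x') := by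
  rw [sqZeroOp, extendBilin_tmul, one_mul, one_smul]; rfl

theorem sqZeroOp_homIncl_right (hj : ∀ ξ ξ', j ξ * j ξ' = 0) (s : Side) (x : D) (w : H →ₗ[K] D) :
    sqZeroOp j S T s (1 ⊗ₜ x) (homIncl D j w) = homIncl D j (S.op s x ∘ₗ w) := by
  induction w using hom_induction with
  | h0 => rw [LinearMap.comp_zero, map_zero, map_zero]
  | h1 ξ d =>
    have h : S.op s x ∘ₗ dualTensorHom K H D (ξ ⊗ₜ d) =
        dualTensorHom K H D (ξ ⊗ₜ S.op s x d) := LinearMap.ext fun α => by simp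
    rw [h, homIncl_dualTensorHom, homIncl_dualTensorHom, tmul_eq_smul (j ξ) d,
      (sqZeroOp j S T s (1 ⊗ₜ x)).map_smul, sqZeroOp_one, smul_add, incl_smul_homIncl j hj, add_zero,
      ← tmul_eq_smul]
  | h2 w w' hw hw' =>
    rw [(homIncl D j).map_add, (sqZeroOp j S T s (1 ⊗ₜ x)).map_add, hw, hw', LinearMap.comp_add,
      (homIncl D j).map_add]

theorem sqZeroOp_homIncl_left (hj : ∀ ξ ξ', j ξ * j ξ' = 0) (s : Side) (x : D) (w : H →ₗ[K] D) :
    sqZeroOp j S T s (homIncl D j w) (1 ⊗ₜ x) = homIncl D j ((S.op s).flip x ∘ₗ w) := by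
  induction w using hom_induction with
  | h0 => rw [LinearMap.comp_zero, map_zero, map_zero, LinearMap.zero_apply]
  | h1 ξ d =>
    have h : (S.op s).flip x ∘ₗ dualTensorHom K H D (ξ ⊗ₜ d) =
        dualTensorHom K H D (ξ ⊗ₜ S.op s d x) := LinearMap.ext fun α => by simp
    rw [h, homIncl_dualTensorHom, homIncl_dualTensorHom, tmul_eq_smul (j ξ) d,
      (sqZeroOp j S T s).map_smul, LinearMap.smul_apply, sqZeroOp_one, smul_add, incl_smul_homIncl j hj,
      add_zero, ← tmul_eq_smul]
  | h2 w w' hw hw' =>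
    rw [(homIncl D j).map_add, (sqZeroOp j S T s).map_add, LinearMap.add_apply, hw, hw',
      LinearMap.comp_add, (homIncl D j).map_add]

theorem axiomDefect_sqZeroOp (hj : ∀ ξ ξ', j ξ * j ξ' = 0) (y : Y 3) (h : ∀ a b c : D,
      T (circ 0 y) a (S.op (circ 2 y) b c) + S.op (circ 0 y) a ∘ₗ T (circ 2 y) b c =
      T (circ 3 y) (S.op (circ 1 y) a b) c + (S.op (circ 3 y)).flip c ∘ₗ T (circ 1 y) a b) :
    axiomDefect (sqZeroOp j S T) y = 0 := by
  refine trilinear_ext fun a b c => ?_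
  have hS := LinearMap.congr_fun (LinearMap.congr_fun (LinearMap.congr_fun
    (S.axiomDefect_eq_zero y) a) b) c
  rw [axiomDefect_apply] at hS
  rw [axiomDefect_apply, sqZeroOp_one j S T _ b c, sqZeroOp_one j S T _ a b,
    (sqZeroOp j S T (circ 0 y) (1 ⊗ₜ a)).map_add, (sqZeroOp j S T (circ 3 y)).map_add,
    LinearMap.add_apply, sqZeroOp_one, sqZeroOp_one, sqZeroOp_homIncl_right j S T hj,
    sqZeroOp_homIncl_left j S T hj, sub_eq_zero.1 hS, add_assoc, add_assoc, ← (homIncl D j).map_add,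
    ← (homIncl D j).map_add, h a b c, sub_self]
  rfl

/-- The deformation with the products `sqZeroOp`. -/
def sqZeroDeformation {ε : B →ₐ[K] K} (hj : ∀ ξ ξ', j ξ * j ξ' = 0) (hε : ∀ ξ, ε (j ξ) = 0)
    (h : ∀ (y : Y 3) (a b c : D),
      T (circ 0 y) a (S.op (circ 2 y) b c) + S.op (circ 0 y) a ∘ₗ T (circ 2 y) b c =
      T (circ 3 y) (S.op (circ 1 y) a b) c + (S.op (circ 3 y)).flip c ∘ₗ T (circ 1 y) a b) :
    Deformation S B ε :=
  Deformation.ofOp (sqZeroOp j S T) (fun y => axiomDefect_sqZeroOp j S T hj y (h y))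
    (fun s x x' => by
      rw [sqZeroOp_one, LinearMap.map_add, contract_homIncl j hε, contract_tmul, add_zero,
        AlgHom.toLinearMap_apply, map_one, one_smul])

theorem sqZeroDeformation_op {ε : B →ₐ[K] K} (hj : ∀ ξ ξ', j ξ * j ξ' = 0)
    (hε : ∀ ξ, ε (j ξ) = 0)
    (h : ∀ (y : Y 3) (a b c : D),
      T (circ 0 y) a (S.op (circ 2 y) b c) + S.op (circ 0 y) a ∘ₗ T (circ 2 y) b c =
      T (circ 3 y) (S.op (circ 1 y) a b) c + (S.op (circ 3 y)).flip c ∘ₗ T (circ 1 y) a b) :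
    (sqZeroDeformation j S T hj hε h).op = sqZeroOp j S T :=
  op_ofDefect _ (fun y => axiomDefect_sqZeroOp j S T hj y (h y))

end SquareZero

variable (S : Dialgebra K D)

/-- The zero cocycle of `C_0 = K` with values in `HY^2(D, D)'`. -/
def infCocycle : harrZ2 (AlgHom.id K K) (Module.Dual K (HY2 S)) := 0

/-- `C_1 = K ⊕ HY^2(D, D)'`, with `HY^2(D, D)'` an ideal of square zero: the extension of `C_0 = K`
by `HY^2(D, D)'` belonging to the zero cocycle. -/
abbrev InfBase : Type (max u v) := HarrExt (infCocycle S)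

/-- The inclusion `i : HY^2(D, D)' → C_1`. -/
abbrev infIncl : Module.Dual K (HY2 S) →ₗ[K] InfBase S := HarrExt.incl (infCocycle S)

/-- The augmentation of `C_1`. -/
abbrev infAug : InfBase S →ₐ[K] K := HarrExt.aug (infCocycle S)

variable {S} [FiniteDimensional K (HY2 S)]

/-- The universal infinitesimal deformation `η_1` with base `C_1`, for a linear map `μ` which chooses
a cocycle in every class of `HY^2(D, D)`. Its products are the `C_1`-bilinear products on
`C_1 ⊗ D = D ⊕ Hom(HY^2(D, D), D)` with `x * x' = (x * x', α ↦ μ(α)(y; x, x'))` for `x, x' ∈ D`,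
where `y = [21]` for `* = ⊣` and `y = [12]` for `* = ⊢`. -/
def universalInfinitesimal (μ : HY2 S →ₗ[K] ZY2 S) : Deformation S (InfBase S) (infAug S) :=
  sqZeroDeformation (infIncl S) S (fun s => evalCocycle μ (sideTree s))
    HarrExt.incl_mul_incl HarrExt.aug_incl
    (evalCocycle_assoc μ)

end Infinitesimal

/-! ## The inductive construction -/

section Construction

variable {K : Type u} {D : Type v} [Field K] [AddCommGroup D] [Module K D] {S : Dialgebra K D}
  {C : Type w} [CommRing C] [Algebra K C] {ε : C →ₐ[K] K}

/-- The ideal `ī (ω' (HY^3(D, D)'))` of the extension `C̄` of `C` by `H^2_Harr(C; K)'`, where `ω'` is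
the dual of the obstruction map `ω` of `η`. -/
def obstrIdeal (η : Deformation S C ε) (μ : HarrH2 ε →ₗ[K] harrZ2 ε K) :
    Ideal (HarrExt (univCocycle μ)) where
  carrier := {x | ∃ ψ : Module.Dual K (HY3 S),
    HarrExt.incl (univCocycle μ) ((obstruction η).dualMap ψ) = x}
  zero_mem' := ⟨0, by simp⟩
  add_mem' := by
    rintro _ _ ⟨ψ, rfl⟩ ⟨ψ', rfl⟩
    exact ⟨ψ + ψ', by simp⟩
  smul_mem' := by
    rintro c _ ⟨ψ, rfl⟩
    exact ⟨ε c.base • ψ, by rw [smul_eq_mul, HarrExt.mul_incl, map_smul]⟩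

theorem mem_obstrIdeal {η : Deformation S C ε} {μ : HarrH2 ε →ₗ[K] harrZ2 ε K}
    {x : HarrExt (univCocycle μ)} : x ∈ obstrIdeal η μ ↔ ∃ ψ : Module.Dual K (HY3 S),
      HarrExt.incl (univCocycle μ) ((obstruction η).dualMap ψ) = x := Iff.rfl

/-- `C_{k+1} = C̄_{k+1} / ī_{k+1} (ω_k' (HY^3(D, D)'))`. -/
abbrev NextBase (η : Deformation S C ε) (μ : HarrH2 ε →ₗ[K] harrZ2 ε K) : Type (max w u) :=
  HarrExt (univCocycle μ) ⧸ obstrIdeal η μ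

/-- The projection `p_{k+1} : C_{k+1} → C_k`. -/
def nextProj (η : Deformation S C ε) (μ : HarrH2 ε →ₗ[K] harrZ2 ε K) : NextBase η μ →ₐ[K] C :=
  Ideal.Quotient.liftₐ (obstrIdeal η μ) (HarrExt.proj (univCocycle μ)) (by
    rintro _ ⟨ψ, rfl⟩
    rfl)

/-- The augmentation of `C_{k+1}`. -/
def nextAug (η : Deformation S C ε) (μ : HarrH2 ε →ₗ[K] harrZ2 ε K) : NextBase η μ →ₐ[K] K :=
  ε.comp (nextProj η μ)

/-- The map `i_{k+1} : (ker ω_k)' → C_{k+1}` induced by `ī_{k+1}`: it sends the restriction of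
`ψ ∈ H^2_Harr(C_k; K)'` to `ker ω_k` to the class of `ī_{k+1}(ψ)`. -/
def nextIncl (η : Deformation S C ε) (μ : HarrH2 ε →ₗ[K] harrZ2 ε K) :
    Module.Dual K (LinearMap.ker (obstruction η)) →ₗ[K] NextBase η μ :=
  Submodule.liftQ (Submodule.dualAnnihilator (LinearMap.ker (obstruction η)))
    ((Ideal.Quotient.mkₐ K (obstrIdeal η μ)).toLinearMap ∘ₗ HarrExt.incl (univCocycle μ)) (by
      intro ψ hψ
      rw [← LinearMap.range_dualMap_eq_dualAnnihilator_ker] at hψ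
      obtain ⟨χ, rfl⟩ := hψ
      rw [LinearMap.mem_ker, LinearMap.comp_apply, AlgHom.toLinearMap_apply,
        Ideal.Quotient.mkₐ_eq_mk, Ideal.Quotient.eq_zero_iff_mem]
      exact ⟨χ, rfl⟩) ∘ₗ
  (Subspace.quotAnnihilatorEquiv (LinearMap.ker (obstruction η))).symm.toLinearMap

theorem nextIncl_restrict (η : Deformation S C ε) (μ : HarrH2 ε →ₗ[K] harrZ2 ε K)
    (ψ : Module.Dual K (HarrH2 ε)) :
    nextIncl η μ (ψ ∘ₗ (LinearMap.ker (obstruction η)).subtype) =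
      Ideal.Quotient.mk (obstrIdeal η μ) (HarrExt.incl (univCocycle μ) ψ) := by
  have h : (Subspace.quotAnnihilatorEquiv (LinearMap.ker (obstruction η))).symm
      (ψ ∘ₗ (LinearMap.ker (obstruction η)).subtype) = Submodule.Quotient.mk ψ := by
    rw [LinearEquiv.symm_apply_eq, Subspace.quotAnnihilatorEquiv_apply]
    rfl
  rw [nextIncl, LinearMap.comp_apply, LinearEquiv.coe_coe, h]
  rfl

end Construction

/-- `IsStage S k C ε η` says that the augmented algebra `(C, ε)` and the deformation `η` of `S` with
base `C` are a `k`-th stage `(C_k, η_k)` of the construction: `C_1 = K ⊕ HY^2(D, D)'` with the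
universal infinitesimal deformation `η_1`, and `C_{k+1}` is obtained from `(C_k, η_k)` as above, with
a deformation `η_{k+1}` which extends `η_k`, i.e. whose push-out along `p_{k+1}` is `η_k`. The
sections `μ` which choose a cocycle in every class are arbitrary. -/
inductive IsStage {K : Type u} {D : Type v} [Field K] [AddCommGroup D] [Module K D]
    (S : Dialgebra K D) [FiniteDimensional K (HY2 S)] :
    ℕ → ∀ (C : Type (max u v)) [CommRing C] [Algebra K C] (ε : C →ₐ[K] K),
      Deformation S C ε → Prop
  | one (μ : HY2 S →ₗ[K] ZY2 S) (hμ : ∀ α, HY2.mk S (μ α) = α) :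
      IsStage S 1 (InfBase S) (infAug S) (universalInfinitesimal μ)
  | succ {k : ℕ} {C : Type (max u v)} [CommRing C] [Algebra K C] {ε : C →ₐ[K] K}
      {η : Deformation S C ε} (h : IsStage S k C ε η)
      (μ : HarrH2 ε →ₗ[K] harrZ2 ε K) (hμ : ∀ α, HarrH2.mk ε (μ α) = α)
      (η' : Deformation S (NextBase η μ) (nextAug η μ))
      (hη' : η'.pushout (nextProj η μ) (fun _ => rfl) = η) :
      IsStage S (k + 1) (NextBase η μ) (nextAug η μ) η'

end DialgDef

end

open DialgDef

/-! Let `0 → H' → B → A → 0` be a small extension, given by a linear family `f_α`, `α ∈ H`, of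
Harrison cocycles, and let `η` be a deformation with base `A`. Lifts of the products of `η` to
`B ⊗ D` correspond to linear maps `Γ : H → CY²(D, D)`, and a lift is a dialgebra structure iff
`δ Γ(α) = -𝕆_η(f_α)` as cochains, for all `α`. The obstructions vanish by construction on `ker ω_k`,
so that a lift to `C_{k+1}` exists.

Two lifts differ by a linear map `H → ZY²(D, D)`. An automorphism `b ↦ b + i(t(p b))` of the
extension, for a derivation `t : A → H'`, changes `Γ` by the infinitesimal deformations in the
directions `t(·)(α)`, and the automorphism `u ↦ u + i(g(ū))` of `B ⊗ D` changes it by the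
coboundaries `δ g(α)`. Hence lifts are unique up to both as soon as every class in `HY²(D, D)` is
the infinitesimal deformation of `η` in the direction of a derivation of `A`. This holds for `C_1`
by the choice of `η_1`, and it passes to every deformation which extends `η_1`. -/

noncomputable section

namespace DialgDef

theorem exists_comp_eq_of_range_le {R P M N : Type*} [Ring R] [AddCommGroup P] [Module R P]
    [Module.Projective R P] [AddCommGroup M] [Module R M] [AddCommGroup N] [Module R N]
    {f : M →ₗ[R] N} {φ : P →ₗ[R] N} (h : LinearMap.range φ ≤ LinearMap.range f) :
    ∃ g : P →ₗ[R] M, f ∘ₗ g = φ := by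
  obtain ⟨g, hg⟩ := Module.projective_lifting_property f.rangeRestrict
    (φ.codRestrict (LinearMap.range f) fun x => h ⟨x, rfl⟩) f.surjective_rangeRestrict
  exact ⟨g, LinearMap.ext fun x => congrArg Subtype.val (LinearMap.congr_fun hg x)⟩

theorem isLocalRing_of_surjective_of_ker_sq_eq_zero {A B : Type*} [CommRing A] [CommRing B]
    [IsLocalRing A] (p : B →+* A) (hp : Function.Surjective p) (h : ∀ x, p x = 0 → x * x = 0) :
    IsLocalRing B := by
  have : IsLocalHom p := ⟨fun b hb => by
    obtain ⟨a, ha⟩ := hb.exists_right_inv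
    obtain ⟨b', rfl⟩ := hp a
    have hnil : IsNilpotent (b * b' - 1) :=
      ⟨2, by rw [pow_two]; exact h _ (by rw [map_sub, map_mul, ha, map_one, sub_self])⟩
    exact isUnit_of_mul_isUnit_left (sub_add_cancel (b * b') 1 ▸ hnil.isUnit_add_one)⟩
  exact RingHom.domain_isLocalRing p

instance Cohom.finiteDimensional {K V : Type*} [Field K] [AddCommGroup V] [Module K V]
    (Z B : Submodule K V) [FiniteDimensional K Z] : FiniteDimensional K (Cohom Z B) :=
  Module.Finite.of_surjective (Cohom.mk Z B) (Cohom.mk_surjective Z B)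

/-! ### Cochains and products -/

theorem prodSide_sideTree (s : Side) : prodSide (sideTree s) = s := by
  cases s <;> decide

theorem face_eq_sideTree (y : Y 3) :
    face 0 y = sideTree (circ 2 y) ∧ face 1 y = sideTree (circ 3 y) ∧
      face 2 y = sideTree (circ 0 y) ∧ face 3 y = sideTree (circ 1 y) := by
  obtain ⟨h0, h1, h2, h3⟩ := prodSide_face y
  simp only [← h0, ← h1, ← h2, ← h3, sideTree_prodSide, and_self]

theorem Dialgebra.op_assoc {R M : Type*} [CommRing R] [AddCommGroup M] [Module R M]
    (S : Dialgebra R M) (y : Y 3) (a b c : M) :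
    S.op (circ 0 y) a (S.op (circ 2 y) b c) = S.op (circ 3 y) (S.op (circ 1 y) a b) c :=
  sub_eq_zero.1 <| LinearMap.congr_fun (LinearMap.congr_fun (LinearMap.congr_fun
    (S.axiomDefect_eq_zero y) a) b) c

section Cochains

variable {K : Type u} {D : Type v} [Field K] [AddCommGroup D] [Module K D] (S : Dialgebra K D)

theorem delta1_apply_sideTree (f : CY1 K D) (s : Side) (a b : D) :
    delta1 S f (sideTree s) a b =
      S.op s a (f ⟨.node () .nil .nil, rfl⟩ b) - f ⟨.node () .nil .nil, rfl⟩ (S.op s a b) +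
        S.op s (f ⟨.node () .nil .nil, rfl⟩ a) b := by
  have hY : ∀ y : Y 1, y = ⟨.node () .nil .nil, rfl⟩ := fun y => Subtype.ext (tree_one y.1 y.2)
  have hcirc : ∀ i : Fin 3, circ i (sideTree s) = s := by cases s <;> decide
  rw [delta1_apply, hY (face 0 _), hY (face 1 _), hY (face 2 _), hcirc 0, hcirc 1, hcirc 2]

theorem delta2_apply_eq_sideTree (f : CY2 K D) (y : Y 3) (a b c : D) :
    delta2 S f y a b c =
      S.op (circ 0 y) a (f (sideTree (circ 2 y)) b c) -
        f (sideTree (circ 3 y)) (S.op (circ 1 y) a b) c +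
        f (sideTree (circ 0 y)) a (S.op (circ 2 y) b c) -
        S.op (circ 3 y) (f (sideTree (circ 1 y)) a b) c := by
  obtain ⟨h0, h1, h2, h3⟩ := face_eq_sideTree y
  rw [delta2_apply, h0, h1, h2, h3]

/-- The values of a linear family `Γ` of `2`-cochains on the `2`-tree of a product, with the
parameter of the family as the last argument. -/
def cochainEval {H : Type*} [AddCommGroup H] [Module K H] (Γ : H →ₗ[K] CY2 K D) (s : Side) :
    D →ₗ[K] D →ₗ[K] H →ₗ[K] D :=
  LinearMap.lflip.toLinearMap ∘ₗ (LinearMap.proj (sideTree s) ∘ₗ Γ).flip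

theorem cochainEval_apply {H : Type*} [AddCommGroup H] [Module K H] (Γ : H →ₗ[K] CY2 K D)
    (s : Side) (x y : D) (α : H) : cochainEval Γ s x y α = Γ α (sideTree s) x y := rfl

end Cochains

/-! ### Contractions -/

section Contract

variable {K : Type u} {D : Type v} [Field K] [AddCommGroup D] [Module K D]
  {A : Type*} [AddCommGroup A] [Module K A] {B : Type*} [AddCommGroup B] [Module K B]
  {H : Type*} [AddCommGroup H] [Module K H]

theorem contract_comp (h : A →ₗ[K] K) (p : B →ₗ[K] A) (u : B ⊗[K] D) :
    contract D (h ∘ₗ p) u = contract D h (p.rTensor D u) := by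
  rw [contract, LinearMap.rTensor_comp]
  rfl

/-- The map `t ⊗ id : A ⊗ D → H' ⊗ D → Hom(H, D)` for a linear map `t : A → H'`. -/
def contractHom (t : A →ₗ[K] Module.Dual K H) : A ⊗[K] D →ₗ[K] H →ₗ[K] D :=
  dualTensorHom K H D ∘ₗ t.rTensor D

theorem contractHom_apply (t : A →ₗ[K] Module.Dual K H) (u : A ⊗[K] D) (α : H) :
    contractHom t u α = contract D (t.flip α) u := by
  induction u using TensorProduct.induction_on with
  | zero => rw [map_zero, map_zero, LinearMap.zero_apply]
  | tmul a d => rw [contract_tmul]; rfl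
  | add u v hu hv => rw [map_add, map_add, LinearMap.add_apply, hu, hv]

theorem contractHom_comp (t : A →ₗ[K] Module.Dual K H) (p : B →ₗ[K] A) (u : B ⊗[K] D) :
    contractHom (t ∘ₗ p) u = contractHom t (p.rTensor D u) := by
  rw [contractHom, LinearMap.rTensor_comp]
  rfl

theorem homIncl_contractHom {R : Type*} [CommRing R] [Algebra K R] [FiniteDimensional K H]
    (j : Module.Dual K H →ₗ[K] R) (t : A →ₗ[K] Module.Dual K H) (u : A ⊗[K] D) :
    homIncl D j (contractHom t u) = (j ∘ₗ t).rTensor D u := by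
  induction u using TensorProduct.induction_on with
  | zero => rw [map_zero, map_zero, map_zero]
  | tmul a d => exact homIncl_dualTensorHom j (t a) d
  | add u v hu hv => rw [map_add, map_add, map_add, hu, hv]

theorem contractHom_homIncl {R : Type*} [CommRing R] [Algebra K R] [FiniteDimensional K H]
    (j : Module.Dual K H →ₗ[K] R) (t : R →ₗ[K] Module.Dual K H) (h : ∀ ξ, t (j ξ) = ξ)
    (w : H →ₗ[K] D) : contractHom t (homIncl D j w) = w := by
  induction w using hom_induction with
  | h0 => rw [map_zero, map_zero]
  | h1 ξ d =>
    rw [homIncl_dualTensorHom]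
    exact congrArg (fun ζ => dualTensorHom K H D (ζ ⊗ₜ d)) (h ξ)
  | h2 w w' hw hw' => rw [map_add, map_add, hw, hw']

end Contract

/-! ### Bilinear products on base changes -/

section Bilinear

variable {K : Type u} {D : Type v} [Field K] [AddCommGroup D] [Module K D]
  {B : Type*} [CommRing B] [Algebra K B]

theorem bilin_ext {N : Type*} [AddCommGroup N] [Module K N] [Module B N] [IsScalarTower K B N]
    {m m' : B ⊗[K] D →ₗ[B] B ⊗[K] D →ₗ[B] N}
    (h : ∀ x y : D, m (1 ⊗ₜ x) (1 ⊗ₜ y) = m' (1 ⊗ₜ x) (1 ⊗ₜ y)) : m = m' := by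
  ext x y
  exact h x y

/-- The restriction `(x, y) ↦ m (1 ⊗ x) (1 ⊗ y)` to `D` of a `B`-bilinear product on `B ⊗ D`; it is
inverse to `extendBilin`. -/
def restrictBilin (m : B ⊗[K] D →ₗ[B] B ⊗[K] D →ₗ[B] B ⊗[K] D) : D →ₗ[K] D →ₗ[K] B ⊗[K] D :=
  (m.restrictScalars₁₂ K K).compl₁₂ (TensorProduct.mk K B D 1) (TensorProduct.mk K B D 1)

theorem restrictBilin_apply (m : B ⊗[K] D →ₗ[B] B ⊗[K] D →ₗ[B] B ⊗[K] D) (x y : D) :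
    restrictBilin m x y = m (1 ⊗ₜ x) (1 ⊗ₜ y) := rfl

theorem extendBilin_one_tmul (b : D →ₗ[K] D →ₗ[K] B ⊗[K] D) (x y : D) :
    extendBilin b (1 ⊗ₜ x) (1 ⊗ₜ y) = b x y := by
  rw [extendBilin_tmul, one_mul, one_smul]

theorem pushBilin_one_tmul {A : Type*} [CommRing A] [Algebra K A] (φ : A →ₐ[K] B)
    (m : A ⊗[K] D →ₗ[A] A ⊗[K] D →ₗ[A] A ⊗[K] D) (x y : D) :
    pushBilin φ m (1 ⊗ₜ x) (1 ⊗ₜ y) = φ.toLinearMap.rTensor D (m (1 ⊗ₜ x) (1 ⊗ₜ y)) := by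
  rw [pushBilin_tmul, one_mul, one_smul]

end Bilinear

/-! ### Deformations and derivations of the base -/

section Deformations

variable {K : Type u} {D : Type v} [Field K] [AddCommGroup D] [Module K D] {S : Dialgebra K D}
  {A : Type*} [CommRing A] [Algebra K A] {ε : A →ₐ[K] K}

theorem Deformation.op_injective :
    Function.Injective fun η : Deformation S A ε => η.op := fun _ _ h =>
  Deformation.ext (congrFun h .left) (congrFun h .right)

theorem Deformation.op_ofOp (m : Side → A ⊗[K] D →ₗ[A] A ⊗[K] D →ₗ[A] A ⊗[K] D)
    (h : ∀ y, axiomDefect m y = 0)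
    (h' : ∀ s x y, contract D ε.toLinearMap (m s (1 ⊗ₜ x) (1 ⊗ₜ y)) = S.op s x y) :
    (Deformation.ofOp m h h').op = m :=
  op_ofDefect m h

/-- `defCochain η h` as a linear map in the linear form `h`. -/
def defCochainLin (η : Deformation S A ε) : (A →ₗ[K] K) →ₗ[K] CY2 K D where
  toFun := defCochain η
  map_add' h h' := by
    funext y
    refine LinearMap.ext₂ fun a b => ?_
    simp only [Pi.add_apply, LinearMap.add_apply, defCochain_apply, contract, LinearMap.rTensor_add,
      LinearMap.comp_apply, map_add]
  map_smul' r h := by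
    funext y
    refine LinearMap.ext₂ fun a b => ?_
    simp only [Pi.smul_apply, LinearMap.smul_apply, defCochain_apply, contract,
      LinearMap.rTensor_smul, LinearMap.comp_apply, map_smul, RingHom.id_apply]

theorem defCochainLin_apply (η : Deformation S A ε) (h : A →ₗ[K] K) :
    defCochainLin η h = defCochain η h := rfl

theorem defCochain_sideTree (η : Deformation S A ε) (h : A →ₗ[K] K) (s : Side) (a b : D) :
    defCochain η h (sideTree s) a b = contract D h (η.op s (1 ⊗ₜ a) (1 ⊗ₜ b)) := by
  rw [defCochain_apply, prodSide_sideTree]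

theorem defCochain_pushout {B : Type*} [CommRing B] [Algebra K B] {ε' : B →ₐ[K] K} (φ : B →ₐ[K] A)
    (hφ : ∀ b, ε (φ b) = ε' b) (η : Deformation S B ε') (h : A →ₗ[K] K) :
    defCochain (η.pushout φ hφ) h = defCochain η (h ∘ₗ φ.toLinearMap) := by
  funext y
  refine LinearMap.ext₂ fun a b => ?_
  rw [defCochain_apply, defCochain_apply, Deformation.pushout_op, pushBilin_one_tmul, contract_comp]

/-- The Harrison `1`-cocycles of `A` with coefficients in `V`: the derivations of `A` in `V`, on
which `A` acts through `ε`. -/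
def harrZ1 (ε : A →ₐ[K] K) (V : Type*) [AddCommGroup V] [Module K V] : Submodule K (A →ₗ[K] V) :=
  LinearMap.ker (harrD1 ε V)

section Derivation

variable {V : Type*} [AddCommGroup V] [Module K V]

theorem mem_harrZ1 {h : A →ₗ[K] V} :
    h ∈ harrZ1 ε V ↔ ∀ a b, h (a * b) = ε a • h b + ε b • h a := by
  rw [harrZ1, LinearMap.mem_ker, LinearMap.ext_iff₂]
  refine forall₂_congr fun a b => ?_
  rw [harrD1_apply, LinearMap.zero_apply, LinearMap.zero_apply, sub_add_eq_add_sub, sub_eq_zero,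
    eq_comm]

theorem map_one_of_mem_harrZ1 {h : A →ₗ[K] V} (hh : h ∈ harrZ1 ε V) : h 1 = 0 := by
  simpa using mem_harrZ1.1 hh 1 1

theorem comp_mem_harrZ1 {B : Type*} [CommRing B] [Algebra K B] {ε' : B →ₐ[K] K} (φ : B →ₐ[K] A)
    (hφ : ∀ b, ε (φ b) = ε' b) {h : A →ₗ[K] V} (hh : h ∈ harrZ1 ε V) :
    h ∘ₗ φ.toLinearMap ∈ harrZ1 ε' V :=
  mem_harrZ1.2 fun a b => by
    simp only [LinearMap.comp_apply, AlgHom.toLinearMap_apply, map_mul, mem_harrZ1.1 hh, hφ]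

end Derivation

theorem defCochain_mem_of_mem_harrZ1 (η : Deformation S A ε) {h : A →ₗ[K] K}
    (hh : h ∈ harrZ1 ε K) : defCochain η h ∈ ZY2 S := by
  rw [LinearMap.mem_ker, ← obstrCochain_coboundary η 0 h (LinearMap.mem_ker.1 hh)]
  exact (obstrLin η).map_zero

/-- The differential of a deformation: the map from the tangent space of the base to `HY²` which
sends a derivation to the infinitesimal deformation in its direction. -/
def differential (η : Deformation S A ε) : harrZ1 ε K →ₗ[K] HY2 S :=
  HY2.mk S ∘ₗ (defCochainLin η ∘ₗ (harrZ1 ε K).subtype).codRestrict (ZY2 S)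
    fun h => defCochain_mem_of_mem_harrZ1 η h.2

theorem differential_apply (η : Deformation S A ε) {h : A →ₗ[K] K} (hh : h ∈ harrZ1 ε K) :
    differential η ⟨h, hh⟩ = HY2.mk S ⟨defCochain η h, defCochain_mem_of_mem_harrZ1 η hh⟩ := rfl

theorem differential_surjective_of_pushout {B : Type*} [CommRing B] [Algebra K B] {ε' : B →ₐ[K] K}
    (φ : B →ₐ[K] A) (hφ : ∀ b, ε (φ b) = ε' b) {η : Deformation S B ε'}
    (h : Function.Surjective (differential (η.pushout φ hφ))) :
    Function.Surjective (differential η) := fun α => by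
  obtain ⟨⟨d, hd⟩, rfl⟩ := h α
  refine ⟨⟨d ∘ₗ φ.toLinearMap, comp_mem_harrZ1 φ hφ hd⟩, ?_⟩
  rw [differential_apply, differential_apply]
  congr 2
  exact (defCochain_pushout φ hφ η d).symm

theorem exists_add_eq_add_delta1 {H : Type*} [AddCommGroup H] [Module K H] {η : Deformation S A ε}
    (h : Function.Surjective (differential η)) (Γ Γ' : H →ₗ[K] CY2 K D)
    (hΓ : ∀ α, delta2 S (Γ α) = delta2 S (Γ' α)) :
    ∃ (θ : H →ₗ[K] harrZ1 ε K) (g : H →ₗ[K] CY1 K D),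
      Γ + defCochainLin η ∘ₗ (harrZ1 ε K).subtype ∘ₗ θ = Γ' + delta1 S ∘ₗ g := by
  let Δ : H →ₗ[K] ZY2 S := (Γ' - Γ).codRestrict (ZY2 S) fun α =>
    LinearMap.mem_ker.2 (by rw [LinearMap.sub_apply, map_sub, hΓ, sub_self])
  obtain ⟨θ, hθ⟩ := exists_comp_eq_of_range_le (f := differential η) (φ := HY2.mk S ∘ₗ Δ)
    (le_top.trans_eq (LinearMap.range_eq_top.2 h).symm)
  have hrange : LinearMap.range (defCochainLin η ∘ₗ (harrZ1 ε K).subtype ∘ₗ θ - (Γ' - Γ)) ≤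
      LinearMap.range (delta1 S) := by
    rintro _ ⟨α, rfl⟩
    refine (Cohom.mk_eq_zero_iff (ZY2 S) _
      (⟨_, defCochain_mem_of_mem_harrZ1 η (θ α).2⟩ - Δ α)).1 ?_
    rw [map_sub]
    exact sub_eq_zero.2 (LinearMap.congr_fun hθ α)
  obtain ⟨g, hg⟩ := exists_comp_eq_of_range_le hrange
  exact ⟨θ, g, by rw [hg]; abel⟩

end Deformations

/-! ### Small extensions -/

/-- A small extension `0 → H' → B → A → 0` of augmented algebras: `B` acts on the ideal `H'` through
its augmentation. It is encoded with a linear splitting, the corresponding coordinate on `H'`, and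
the linear family of Harrison cocycles on `A` which describes the product of `B`. -/
structure SmallExtension {K A B : Type*} [Field K] [CommRing A] [Algebra K A] [CommRing B]
    [Algebra K B] (p : B →ₐ[K] A) (ε : A →ₐ[K] K) (H : Type*) [AddCommGroup H] [Module K H] where
  incl : Module.Dual K H →ₗ[K] B
  split : A →ₗ[K] B
  coord : B →ₗ[K] Module.Dual K H
  cocycle : H →ₗ[K] harrZ2 ε K
  proj_split : ∀ a, p (split a) = a
  coord_incl : ∀ ξ, coord (incl ξ) = ξ
  split_add_incl : ∀ b, split (p b) + incl (coord b) = b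
  mul_incl : ∀ b ξ, b * incl ξ = ε (p b) • incl ξ
  coord_mul : ∀ a a' α, coord (split a * split a') α = (cocycle α).1 a a'

namespace SmallExtension

section Algebra

variable {K A B H : Type*} [Field K] [CommRing A] [Algebra K A] [CommRing B] [Algebra K B]
  [AddCommGroup H] [Module K H] {p : B →ₐ[K] A} {ε : A →ₐ[K] K} (X : SmallExtension p ε H)

include X

theorem incl_injective : Function.Injective X.incl :=
  Function.LeftInverse.injective X.coord_incl

theorem proj_surjective : Function.Surjective p :=
  Function.RightInverse.surjective X.proj_split

theorem proj_incl (ξ : Module.Dual K H) : p (X.incl ξ) = 0 := by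
  have h := X.split_add_incl (X.incl ξ)
  rw [X.coord_incl, add_eq_right] at h
  rw [← X.proj_split (p (X.incl ξ)), h, map_zero]

theorem coord_split (a : A) : X.coord (X.split a) = 0 := by
  have h := X.split_add_incl (X.split a)
  rw [X.proj_split, add_eq_left] at h
  rw [← X.coord_incl (X.coord (X.split a)), h, map_zero]

theorem exact : Function.Exact X.incl p := fun b => by
  refine ⟨fun hb => ⟨X.coord b, ?_⟩, ?_⟩
  · simpa only [hb, map_zero, zero_add] using X.split_add_incl b
  · rintro ⟨ξ, rfl⟩
    exact X.proj_incl ξ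

theorem incl_mul_incl (ξ ξ' : Module.Dual K H) : X.incl ξ * X.incl ξ' = 0 := by
  rw [X.mul_incl, X.proj_incl, map_zero, zero_smul]

theorem isLocalRing [IsLocalRing A] : IsLocalRing B :=
  isLocalRing_of_surjective_of_ker_sq_eq_zero p.toRingHom X.proj_surjective fun b hb => by
    obtain ⟨ξ, rfl⟩ := (X.exact b).1 hb
    exact X.incl_mul_incl ξ ξ

theorem finiteDimensional [FiniteDimensional K A] [FiniteDimensional K H] :
    FiniteDimensional K B :=
  Module.Finite.of_surjective (X.split.coprod X.incl) fun b => ⟨(p b, X.coord b),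
    X.split_add_incl b⟩

end Algebra

section Tensor

variable {K : Type u} {D : Type v} [Field K] [AddCommGroup D] [Module K D]
  {A : Type*} [CommRing A] [Algebra K A] {B : Type*} [CommRing B] [Algebra K B]
  {H : Type*} [AddCommGroup H] [Module K H]
  {p : B →ₐ[K] A} {ε : A →ₐ[K] K} (X : SmallExtension p ε H)

theorem rTensor_proj_split (u : A ⊗[K] D) :
    p.toLinearMap.rTensor D (X.split.rTensor D u) = u := by
  rw [← LinearMap.comp_apply, ← LinearMap.rTensor_comp,
    show p.toLinearMap ∘ₗ X.split = LinearMap.id from LinearMap.ext X.proj_split,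
    LinearMap.rTensor_id, LinearMap.id_apply]

theorem contractHom_coord_split (u : A ⊗[K] D) :
    contractHom X.coord (X.split.rTensor D u) = 0 := by
  rw [← contractHom_comp, show X.coord ∘ₗ X.split = 0 from LinearMap.ext X.coord_split, contractHom,
    LinearMap.rTensor_zero, LinearMap.comp_zero, LinearMap.zero_apply]

theorem contractHom_coord_split_smul (a : A) (u : A ⊗[K] D) (α : H) :
    contractHom X.coord (X.split a • X.split.rTensor D u) α =
      contract D ((X.cocycle α).1 a) u := by
  rw [contractHom_apply]
  induction u using TensorProduct.induction_on with
  | zero => rw [map_zero, smul_zero, map_zero, map_zero]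
  | tmul a' d =>
    rw [LinearMap.rTensor_tmul, TensorProduct.smul_tmul', smul_eq_mul, contract_tmul,
      contract_tmul, LinearMap.flip_apply, X.coord_mul]
  | add u v hu hv => rw [map_add, smul_add, map_add, hu, hv, map_add]

variable [FiniteDimensional K H]

theorem rTensor_proj_homIncl (w : H →ₗ[K] D) :
    p.toLinearMap.rTensor D (homIncl D X.incl w) = 0 := by
  rw [homIncl, LinearMap.comp_apply, ← LinearMap.comp_apply, ← LinearMap.rTensor_comp,
    show p.toLinearMap ∘ₗ X.incl = 0 from LinearMap.ext X.proj_incl, LinearMap.rTensor_zero,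
    LinearMap.zero_apply]

theorem contractHom_coord_homIncl (w : H →ₗ[K] D) :
    contractHom X.coord (homIncl D X.incl w) = w :=
  contractHom_homIncl X.incl X.coord X.coord_incl w

theorem split_add_homIncl (u : B ⊗[K] D) :
    X.split.rTensor D (p.toLinearMap.rTensor D u) +
      homIncl D X.incl (contractHom X.coord u) = u := by
  rw [homIncl_contractHom, ← LinearMap.comp_apply, ← LinearMap.rTensor_comp, ← LinearMap.add_apply,
    ← LinearMap.rTensor_add,
    show X.split ∘ₗ p.toLinearMap + X.incl ∘ₗ X.coord = LinearMap.id from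
      LinearMap.ext X.split_add_incl, LinearMap.rTensor_id, LinearMap.id_apply]

theorem eq_zero_of_coord {u : B ⊗[K] D} (h : p.toLinearMap.rTensor D u = 0)
    (h' : contractHom X.coord u = 0) : u = 0 := by
  rw [← X.split_add_homIncl u, h, h', map_zero, map_zero, add_zero]

theorem contract_aug_homIncl (w : H →ₗ[K] D) :
    contract D (ε.comp p).toLinearMap (homIncl D X.incl w) = 0 :=
  contract_homIncl X.incl (fun ξ => by rw [AlgHom.comp_apply, X.proj_incl, map_zero]) w

theorem smul_homIncl (b : B) (w : H →ₗ[K] D) :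
    b • homIncl D X.incl w = homIncl D X.incl (ε (p b) • w) := by
  induction w using hom_induction with
  | h0 => rw [smul_zero, map_zero, smul_zero]
  | h1 ξ d =>
    rw [map_smul, homIncl_dualTensorHom, TensorProduct.smul_tmul', smul_eq_mul, X.mul_incl,
      ← TensorProduct.smul_tmul']
  | h2 w w' hw hw' => rw [map_add, smul_add, hw, hw', smul_add, map_add]

theorem incl_smul (ξ : Module.Dual K H) (u : B ⊗[K] D) :
    X.incl ξ • u =
      homIncl D X.incl (dualTensorHom K H D (ξ ⊗ₜ contract D (ε.comp p).toLinearMap u)) := by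
  rw [homIncl_dualTensorHom]
  induction u using TensorProduct.induction_on with
  | zero => rw [smul_zero, map_zero, TensorProduct.tmul_zero]
  | tmul b d =>
    rw [contract_tmul, TensorProduct.smul_tmul', smul_eq_mul, mul_comm, X.mul_incl,
      TensorProduct.smul_tmul]
    rfl
  | add u v hu hv => rw [smul_add, hu, hv, map_add, TensorProduct.tmul_add]

variable {m : B ⊗[K] D →ₗ[B] B ⊗[K] D →ₗ[B] B ⊗[K] D} {o : D →ₗ[K] D →ₗ[K] D}

theorem bilin_homIncl_right
    (hm : ∀ u v, contract D (ε.comp p).toLinearMap (m u v) =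
      o (contract D (ε.comp p).toLinearMap u) (contract D (ε.comp p).toLinearMap v))
    (u : B ⊗[K] D) (w : H →ₗ[K] D) :
    m u (homIncl D X.incl w) =
      homIncl D X.incl (o (contract D (ε.comp p).toLinearMap u) ∘ₗ w) := by
  induction w using hom_induction with
  | h0 => rw [map_zero, map_zero, LinearMap.comp_zero, map_zero]
  | h1 ξ d =>
    rw [homIncl_dualTensorHom, tmul_eq_smul, map_smul, X.incl_smul, hm, contract_tmul]
    simp only [AlgHom.toLinearMap_apply, map_one, one_smul]
    congr 1
    ext α
    simp only [dualTensorHom_apply, LinearMap.comp_apply, map_smul]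
  | h2 w w' hw hw' => rw [map_add, map_add, hw, hw', LinearMap.comp_add, map_add]

theorem bilin_homIncl_left
    (hm : ∀ u v, contract D (ε.comp p).toLinearMap (m u v) =
      o (contract D (ε.comp p).toLinearMap u) (contract D (ε.comp p).toLinearMap v))
    (w : H →ₗ[K] D) (v : B ⊗[K] D) :
    m (homIncl D X.incl w) v =
      homIncl D X.incl (o.flip (contract D (ε.comp p).toLinearMap v) ∘ₗ w) :=
  X.bilin_homIncl_right (m := m.flip) (o := o.flip) (fun u v => hm v u) v w

end Tensor

/-! ### Lifting products along a small extension -/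

section Lift

variable {K : Type u} {D : Type v} [Field K] [AddCommGroup D] [Module K D]
  {A : Type*} [CommRing A] [Algebra K A] {B : Type*} [CommRing B] [Algebra K B]
  {H : Type*} [AddCommGroup H] [Module K H] [FiniteDimensional K H]
  {p : B →ₐ[K] A} {ε : A →ₐ[K] K} (X : SmallExtension p ε H)
  (m : A ⊗[K] D →ₗ[A] A ⊗[K] D →ₗ[A] A ⊗[K] D) (c : D →ₗ[K] D →ₗ[K] H →ₗ[K] D)

/-- The lift to `B ⊗ D` of a product on `A ⊗ D` whose `H'`-component on `D` is `c`, under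
`H' ⊗ D = Hom(H, D)`. -/
def liftProduct : B ⊗[K] D →ₗ[B] B ⊗[K] D →ₗ[B] B ⊗[K] D :=
  extendBilin ((restrictBilin m).compr₂ (X.split.rTensor D) + c.compr₂ (homIncl D X.incl))

theorem liftProduct_one_tmul (x y : D) :
    X.liftProduct m c (1 ⊗ₜ x) (1 ⊗ₜ y) =
      X.split.rTensor D (m (1 ⊗ₜ x) (1 ⊗ₜ y)) + homIncl D X.incl (c x y) :=
  extendBilin_one_tmul _ x y

theorem liftProduct_flip : (X.liftProduct m c).flip = X.liftProduct m.flip c.flip :=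
  bilin_ext fun x y => by
    rw [LinearMap.flip_apply, liftProduct_one_tmul, liftProduct_one_tmul, LinearMap.flip_apply,
      LinearMap.flip_apply]

theorem pushBilin_liftProduct : pushBilin p (X.liftProduct m c) = m :=
  bilin_ext fun x y => by
    rw [pushBilin_one_tmul, liftProduct_one_tmul, map_add, rTensor_proj_split,
      rTensor_proj_homIncl, add_zero]

theorem rTensor_proj_liftProduct (u v : B ⊗[K] D) :
    p.toLinearMap.rTensor D (X.liftProduct m c u v) =
      m (p.toLinearMap.rTensor D u) (p.toLinearMap.rTensor D v) := by
  rw [← pushBilin_rTensor, pushBilin_liftProduct]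

theorem eq_liftProduct (m' : B ⊗[K] D →ₗ[B] B ⊗[K] D →ₗ[B] B ⊗[K] D) :
    m' = X.liftProduct (pushBilin p m') ((restrictBilin m').compr₂ (contractHom X.coord)) :=
  bilin_ext fun x y => by
    rw [liftProduct_one_tmul, pushBilin_one_tmul, LinearMap.compr₂_apply, restrictBilin_apply,
      split_add_homIncl]

theorem contractHom_coord_liftProduct (x y : D) :
    contractHom X.coord (X.liftProduct m c (1 ⊗ₜ x) (1 ⊗ₜ y)) = c x y := by
  rw [liftProduct_one_tmul, map_add, contractHom_coord_split, contractHom_coord_homIncl, zero_add]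

variable {m} {o : D →ₗ[K] D →ₗ[K] D}
  (hm : ∀ u v, contract D ε.toLinearMap (m u v) =
    o (contract D ε.toLinearMap u) (contract D ε.toLinearMap v))

include hm

theorem contract_aug_liftProduct (u v : B ⊗[K] D) :
    contract D (ε.comp p).toLinearMap (X.liftProduct m c u v) =
      o (contract D (ε.comp p).toLinearMap u) (contract D (ε.comp p).toLinearMap v) := by
  simp only [AlgHom.comp_toLinearMap, contract_comp, rTensor_proj_liftProduct, hm]

theorem contractHom_coord_liftProduct_left (x : D) (u : B ⊗[K] D) (α : H) :
    contractHom X.coord (X.liftProduct m c (1 ⊗ₜ x) u) α =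
      nest (X.cocycle α).1 (leftMul m x) (p.toLinearMap.rTensor D u) +
        c x (contract D (ε.comp p).toLinearMap u) α + o x (contractHom X.coord u α) := by
  have on_split (v : A ⊗[K] D) :
      contractHom X.coord (X.liftProduct m c (1 ⊗ₜ x) (X.split.rTensor D v)) α =
        nest (X.cocycle α).1 (leftMul m x) v + c x (contract D ε.toLinearMap v) α := by
    induction v using TensorProduct.induction_on with
    | zero => simp only [map_zero, LinearMap.zero_apply, add_zero]
    | tmul a d =>
      rw [LinearMap.rTensor_tmul, tmul_eq_smul (X.split a), map_smul, liftProduct_one_tmul,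
        smul_add, map_add, LinearMap.add_apply, contractHom_coord_split_smul, smul_homIncl,
        contractHom_coord_homIncl, X.proj_split, nest_tmul, contract_tmul, map_smul]
      rfl
    | add v v' hv hv' =>
      simp only [map_add, LinearMap.add_apply, hv, hv']
      abel
  have on_homIncl (w : H →ₗ[K] D) :
      contractHom X.coord (X.liftProduct m c (1 ⊗ₜ x) (homIncl D X.incl w)) α = o x (w α) := by
    rw [X.bilin_homIncl_right (X.contract_aug_liftProduct c hm), contractHom_coord_homIncl,
      contract_tmul, AlgHom.toLinearMap_apply, map_one, one_smul, LinearMap.comp_apply]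
  conv_lhs => rw [← X.split_add_homIncl u]
  rw [map_add, map_add, LinearMap.add_apply, on_split, on_homIncl, ← contract_comp,
    ← AlgHom.comp_toLinearMap]

theorem contractHom_coord_liftProduct_right (x : D) (u : B ⊗[K] D) (α : H) :
    contractHom X.coord (X.liftProduct m c u (1 ⊗ₜ x)) α =
      nest (X.cocycle α).1 (rightMul m x) (p.toLinearMap.rTensor D u) +
        c (contract D (ε.comp p).toLinearMap u) x α + o (contractHom X.coord u α) x := by
  rw [← LinearMap.flip_apply (X.liftProduct m c), liftProduct_flip]
  exact X.contractHom_coord_liftProduct_left (m := m.flip) (o := o.flip) c.flip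
    (fun u v => hm v u) x u α

end Lift

section LiftedOp

variable {K : Type u} {D : Type v} [Field K] [AddCommGroup D] [Module K D] {S : Dialgebra K D}
  {A : Type*} [CommRing A] [Algebra K A] {B : Type*} [CommRing B] [Algebra K B]
  {H : Type*} [AddCommGroup H] [Module K H] [FiniteDimensional K H]
  {p : B →ₐ[K] A} {ε : A →ₐ[K] K} (X : SmallExtension p ε H)

/-- The lifts to `B ⊗ D` of the products of a deformation with base `A` whose `H'`-components are
the values of `Γ`. -/
def liftedOp (η : Deformation S A ε) (Γ : H →ₗ[K] CY2 K D) (s : Side) :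
    B ⊗[K] D →ₗ[B] B ⊗[K] D →ₗ[B] B ⊗[K] D :=
  X.liftProduct (η.op s) (cochainEval Γ s)

theorem contractHom_coord_axiomDefect_liftedOp (η : Deformation S A ε) (Γ : H →ₗ[K] CY2 K D)
    (y : Y 3) (a b c : D) (α : H) :
    contractHom X.coord (axiomDefect (X.liftedOp η Γ) y (1 ⊗ₜ a) (1 ⊗ₜ b) (1 ⊗ₜ c)) α =
      delta2 S (Γ α) y a b c + obstrCochain η (X.cocycle α) y a b c := by
  have aug_one (x : D) : contract D (ε.comp p).toLinearMap (1 ⊗ₜ x) = x := by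
    rw [contract_tmul, AlgHom.toLinearMap_apply, map_one, one_smul]
  have proj_one (x : D) : p.toLinearMap.rTensor D (1 ⊗ₜ x) = 1 ⊗ₜ x := by
    rw [LinearMap.rTensor_tmul, AlgHom.toLinearMap_apply, map_one]
  simp only [axiomDefect_apply, map_sub, LinearMap.sub_apply, liftedOp,
    contractHom_coord_liftProduct_left X _ (η.aug_op _),
    contractHom_coord_liftProduct_right X _ (η.aug_op _), rTensor_proj_liftProduct,
    contract_aug_liftProduct X _ (η.aug_op _), contractHom_coord_liftProduct, aug_one, proj_one,
    cochainEval_apply, obstrCochain_eq_nest, delta2_apply_eq_sideTree]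
  abel

theorem axiomDefect_liftedOp_eq_zero_iff (η : Deformation S A ε) (Γ : H →ₗ[K] CY2 K D) :
    (∀ y, axiomDefect (X.liftedOp η Γ) y = 0) ↔
      ∀ α, delta2 S (Γ α) = -obstrCochain η (X.cocycle α) := by
  constructor
  · refine fun h α => eq_neg_of_add_eq_zero_left <| funext fun y =>
      LinearMap.ext fun a => LinearMap.ext₂ fun b c => ?_
    refine (X.contractHom_coord_axiomDefect_liftedOp η Γ y a b c α).symm.trans ?_
    simp only [h, LinearMap.zero_apply, map_zero, Pi.zero_apply]
  · refine fun h y => trilinear_ext fun a b c => X.eq_zero_of_coord ?_ (LinearMap.ext fun α => ?_)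
    · simp only [axiomDefect_apply, map_sub, liftedOp, rTensor_proj_liftProduct, η.op_assoc,
        sub_self]
    · rw [contractHom_coord_axiomDefect_liftedOp, h]
      exact neg_add_cancel _

theorem op_eq_liftedOp (η : Deformation S B (ε.comp p)) :
    η.op = X.liftedOp (η.pushout p fun b => (ε.comp_apply p b).symm)
      (defCochainLin η ∘ₗ X.coord.flip) := by
  funext s
  conv_lhs => rw [X.eq_liftProduct (η.op s)]
  rw [liftedOp, Deformation.pushout_op]
  congr 1
  refine LinearMap.ext₂ fun x y => LinearMap.ext fun α => ?_
  rw [cochainEval_apply, LinearMap.comp_apply, defCochainLin_apply, defCochain_sideTree,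
    LinearMap.compr₂_apply, restrictBilin_apply, contractHom_apply]

end LiftedOp

/-! ### Existence and uniqueness of lifts of deformations -/

section Existence

variable {K : Type u} {D : Type v} [Field K] [AddCommGroup D] [Module K D] {S : Dialgebra K D}
  {A : Type*} [CommRing A] [Algebra K A] {B : Type*} [CommRing B] [Algebra K B]
  {H : Type*} [AddCommGroup H] [Module K H] [FiniteDimensional K H]
  {p : B →ₐ[K] A} {ε : A →ₐ[K] K} (X : SmallExtension p ε H)

theorem exists_pushout_eq (η : Deformation S A ε)
    (h : ∀ α, obstruction η (HarrH2.mk ε (X.cocycle α)) = 0) :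
    ∃ η' : Deformation S B (ε.comp p), η'.pushout p (fun b => (ε.comp_apply p b).symm) = η := by
  have hrange : LinearMap.range (-(obstrLin η ∘ₗ X.cocycle)) ≤ LinearMap.range (delta2 S) := by
    rintro _ ⟨α, rfl⟩
    have hα := h α
    rw [obstruction_mk, Cohom.mk_eq_zero_iff] at hα
    exact neg_mem hα
  obtain ⟨Γ, hΓ⟩ := exists_comp_eq_of_range_le hrange
  refine ⟨Deformation.ofOp (X.liftedOp η Γ)
    ((X.axiomDefect_liftedOp_eq_zero_iff η Γ).2 (LinearMap.congr_fun hΓ)) fun s x y => ?_, ?_⟩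
  · rw [liftedOp, X.contract_aug_liftProduct _ (η.aug_op s)]
    simp only [contract_tmul, AlgHom.toLinearMap_apply, map_one, one_smul]
  · refine Deformation.op_injective (funext fun s => ?_)
    simp only [Deformation.pushout_op, Deformation.op_ofOp]
    exact X.pushBilin_liftProduct _ _

end Existence

section Automorphism

variable {K A B H : Type*} [Field K] [CommRing A] [Algebra K A] [CommRing B] [Algebra K B]
  [AddCommGroup H] [Module K H] {p : B →ₐ[K] A} {ε : A →ₐ[K] K} (X : SmallExtension p ε H)

/-- The endomorphism `b ↦ b + i(t(p b))` of the extension `H' → B → A` given by a derivation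
`t : A → H'`. -/
def autHom (t : harrZ1 ε (Module.Dual K H)) : B →ₐ[K] B :=
  AlgHom.ofLinearMap (LinearMap.id + X.incl ∘ₗ t.1 ∘ₗ p.toLinearMap)
    (by simp [map_one_of_mem_harrZ1 t.2])
    (fun b b' => by
      simp only [LinearMap.add_apply, LinearMap.id_apply, LinearMap.comp_apply,
        AlgHom.toLinearMap_apply, map_mul, mem_harrZ1.1 t.2, map_add, map_smul, add_mul, mul_add,
        X.proj_incl, add_zero, mul_comm (X.incl _) b', X.mul_incl]
      abel)

theorem autHom_apply (t : harrZ1 ε (Module.Dual K H)) (b : B) :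
    X.autHom t b = b + X.incl (t.1 (p b)) := rfl

theorem proj_autHom (t : harrZ1 ε (Module.Dual K H)) (b : B) : p (X.autHom t b) = p b := by
  rw [autHom_apply, map_add, X.proj_incl, add_zero]

theorem autHom_neg_autHom (t : harrZ1 ε (Module.Dual K H)) (b : B) :
    X.autHom (-t) (X.autHom t b) = b := by
  rw [autHom_apply, proj_autHom, autHom_apply, Submodule.coe_neg, LinearMap.neg_apply, map_neg,
    add_neg_cancel_right]

/-- `autHom` as an automorphism. -/
def aut (t : harrZ1 ε (Module.Dual K H)) : B ≃ₐ[K] B :=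
  AlgEquiv.ofAlgHom (X.autHom t) (X.autHom (-t))
    (AlgHom.ext fun b => by
      have h := X.autHom_neg_autHom (-t) b
      rwa [neg_neg] at h)
    (AlgHom.ext (X.autHom_neg_autHom t))

theorem proj_aut (t : harrZ1 ε (Module.Dual K H)) (b : B) : p (X.aut t b) = p b :=
  X.proj_autHom t b

theorem aut_incl (t : harrZ1 ε (Module.Dual K H)) (ξ : Module.Dual K H) :
    X.aut t (X.incl ξ) = X.incl ξ := by
  refine (X.autHom_apply t (X.incl ξ)).trans ?_
  rw [X.proj_incl, map_zero, map_zero, add_zero]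

end Automorphism

section Uniqueness

variable {K : Type u} {D : Type v} [Field K] [AddCommGroup D] [Module K D] {S : Dialgebra K D}
  {A : Type*} [CommRing A] [Algebra K A] {B : Type*} [CommRing B] [Algebra K B]
  {H : Type*} [AddCommGroup H] [Module K H] [FiniteDimensional K H]
  {p : B →ₐ[K] A} {ε : A →ₐ[K] K} (X : SmallExtension p ε H)

theorem rTensor_aut (t : harrZ1 ε (Module.Dual K H)) (u : B ⊗[K] D) :
    (X.aut t).toAlgHom.toLinearMap.rTensor D u =
      u + homIncl D X.incl (contractHom t.1 (p.toLinearMap.rTensor D u)) := by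
  rw [← contractHom_comp, homIncl_contractHom,
    show (X.aut t).toAlgHom.toLinearMap = LinearMap.id + X.incl ∘ₗ t.1 ∘ₗ p.toLinearMap from rfl,
    LinearMap.rTensor_add, LinearMap.rTensor_id, LinearMap.add_apply, LinearMap.id_apply]

theorem pushBilin_aut_liftedOp (t : harrZ1 ε (Module.Dual K H)) (η : Deformation S A ε)
    (Γ : H →ₗ[K] CY2 K D) (s : Side) :
    pushBilin (X.aut t).toAlgHom (X.liftedOp η Γ s) =
      X.liftedOp η (Γ + defCochainLin η ∘ₗ t.1.flip) s := by
  refine bilin_ext fun x y => ?_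
  have cochainEval_add : cochainEval (Γ + defCochainLin η ∘ₗ t.1.flip) s x y =
      cochainEval Γ s x y + contractHom t.1 (η.op s (1 ⊗ₜ x) (1 ⊗ₜ y)) := by
    ext α
    rw [cochainEval_apply, LinearMap.add_apply, LinearMap.add_apply, contractHom_apply,
      ← defCochain_sideTree]
    rfl
  rw [pushBilin_one_tmul, rTensor_aut, liftedOp, liftedOp, rTensor_proj_liftProduct,
    liftProduct_one_tmul, liftProduct_one_tmul, cochainEval_add, map_add, add_assoc]
  simp only [LinearMap.rTensor_tmul, AlgHom.toLinearMap_apply, map_one]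

/-- The automorphism `u ↦ u + g(ū)` of the `B`-module `B ⊗ D`, where `ū` is the image of `u` in `D`
and `Hom(H, D) = H' ⊗ D` is embedded in `B ⊗ D`. -/
def shear (g : D →ₗ[K] H →ₗ[K] D) : B ⊗[K] D ≃ₗ[B] B ⊗[K] D where
  toFun u := u + homIncl D X.incl (g (contract D (ε.comp p).toLinearMap u))
  invFun u := u - homIncl D X.incl (g (contract D (ε.comp p).toLinearMap u))
  map_add' u v := by
    simp only [map_add]
    abel
  map_smul' b u := by
    rw [contract_smul, map_smul, AlgHom.comp_apply, ← smul_homIncl, smul_add, RingHom.id_apply]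
  left_inv u := by
    simp only [map_add, contract_aug_homIncl, add_zero, add_sub_cancel_right]
  right_inv u := by
    simp only [map_sub, contract_aug_homIncl, sub_zero, sub_add_cancel]

theorem shear_apply (g : D →ₗ[K] H →ₗ[K] D) (u : B ⊗[K] D) :
    X.shear g u = u + homIncl D X.incl (g (contract D (ε.comp p).toLinearMap u)) := rfl

theorem shear_liftProduct {m : A ⊗[K] D →ₗ[A] A ⊗[K] D →ₗ[A] A ⊗[K] D} {o : D →ₗ[K] D →ₗ[K] D}
    (hm : ∀ u v, contract D ε.toLinearMap (m u v) =
      o (contract D ε.toLinearMap u) (contract D ε.toLinearMap v))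
    {c c' : D →ₗ[K] D →ₗ[K] H →ₗ[K] D} {g : D →ₗ[K] H →ₗ[K] D}
    (h : ∀ x y, c' x y + g (o x y) = c x y + o.flip y ∘ₗ g x + o x ∘ₗ g y) (u v : B ⊗[K] D) :
    X.shear g (X.liftProduct m c' u v) = X.liftProduct m c (X.shear g u) (X.shear g v) := by
  have hlift := X.contract_aug_liftProduct c hm
  have aug_one (x : D) : contract D (ε.comp p).toLinearMap (1 ⊗ₜ x) = x := by
    rw [contract_tmul, AlgHom.toLinearMap_apply, map_one, one_smul]
  refine LinearMap.congr_fun₂ (f := (X.liftProduct m c').compr₂ (X.shear g).toLinearMap)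
    (g := (X.liftProduct m c).compl₁₂ (X.shear g).toLinearMap (X.shear g).toLinearMap)
    (bilin_ext fun x y => ?_) u v
  simp only [LinearMap.compr₂_apply, LinearMap.compl₁₂_apply, LinearEquiv.coe_coe, shear_apply,
    map_add, LinearMap.add_apply, X.contract_aug_liftProduct c' hm, X.bilin_homIncl_right hlift,
    X.bilin_homIncl_left hlift, contract_aug_homIncl, aug_one, map_zero, LinearMap.zero_comp,
    add_zero]
  rw [liftProduct_one_tmul, liftProduct_one_tmul, add_assoc, ← map_add, h]
  simp only [map_add, add_assoc]

theorem equivalent_of_op_eq {η : Deformation S A ε} {η' η'' : Deformation S B (ε.comp p)}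
    {Γ : H →ₗ[K] CY2 K D} {g : H →ₗ[K] CY1 K D}
    (h' : η'.op = X.liftedOp η (Γ + delta1 S ∘ₗ g)) (h'' : η''.op = X.liftedOp η Γ) :
    η'.Equivalent η'' := by
  let G : D →ₗ[K] H →ₗ[K] D := (LinearMap.proj ⟨.node () .nil .nil, rfl⟩ ∘ₗ g).flip
  have G_apply (x : D) (α : H) : G x α = g α ⟨.node () .nil .nil, rfl⟩ x := rfl
  have shear_op (s : Side) (u v : B ⊗[K] D) :
      X.shear G (η'.op s u v) = η''.op s (X.shear G u) (X.shear G v) := by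
    rw [h', h'']
    refine X.shear_liftProduct (η.aug_op s) (fun x y => LinearMap.ext fun α => ?_) u v
    simp only [LinearMap.add_apply, LinearMap.comp_apply, cochainEval_apply, Pi.add_apply,
      delta1_apply_sideTree, LinearMap.flip_apply, G_apply]
    abel
  exact ⟨X.shear G, shear_op .left, shear_op .right, fun u => by
    rw [shear_apply, map_add, contract_aug_homIncl, add_zero]⟩

end Uniqueness

section Versal

variable {K : Type u} {D : Type v} [Field K] [AddCommGroup D] [Module K D] {S : Dialgebra K D}
  {A : Type*} [CommRing A] [Algebra K A] {B : Type*} [CommRing B] [Algebra K B]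
  {H : Type*} [AddCommGroup H] [Module K H] [FiniteDimensional K H]
  {p : B →ₐ[K] A} {ε : A →ₐ[K] K} (X : SmallExtension p ε H)

theorem exists_aut_equivalent {η : Deformation S A ε}
    (h : Function.Surjective (differential η)) {η' η'' : Deformation S B (ε.comp p)}
    (h' : η'.pushout p (fun b => (ε.comp_apply p b).symm) = η)
    (h'' : η''.pushout p (fun b => (ε.comp_apply p b).symm) = η) :
    ∃ (r : B ≃ₐ[K] B) (hr : ∀ b, p (r b) = p b), (∀ ξ, r (X.incl ξ) = X.incl ξ) ∧
      (η'.pushout r.toAlgHom fun b => congrArg ε (hr b)).Equivalent η'' := by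
  have lift_iff (η' : Deformation S B (ε.comp p))
      (h' : η'.pushout p (fun b => (ε.comp_apply p b).symm) = η) :
      ∃ Γ, η'.op = X.liftedOp η Γ ∧ ∀ α, delta2 S (Γ α) = -obstrCochain η (X.cocycle α) := by
    have hop := X.op_eq_liftedOp η'
    rw [h'] at hop
    exact ⟨_, hop, (X.axiomDefect_liftedOp_eq_zero_iff η _).1 (hop ▸ η'.axiomDefect_eq_zero)⟩
  obtain ⟨Γ', hop', hΓ'⟩ := lift_iff η' h'
  obtain ⟨Γ'', hop'', hΓ''⟩ := lift_iff η'' h''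
  obtain ⟨θ, g, hg⟩ := exists_add_eq_add_delta1 h Γ' Γ'' fun α => (hΓ' α).trans (hΓ'' α).symm
  let t : harrZ1 ε (Module.Dual K H) := ⟨((harrZ1 ε K).subtype ∘ₗ θ).flip,
    mem_harrZ1.2 fun a b => LinearMap.ext fun α => mem_harrZ1.1 (θ α).2 a b⟩
  refine ⟨X.aut t, X.proj_aut t, X.aut_incl t, X.equivalent_of_op_eq (η := η) (g := g) ?_ hop''⟩
  refine (Deformation.pushout_op _ _ η').trans ?_
  rw [hop', ← hg]
  exact funext (X.pushBilin_aut_liftedOp t η Γ')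

end Versal

end SmallExtension

/-! ### The extension `C_{k+1}` of `C_k` -/

section Next

variable {K : Type u} {D : Type v} [Field K] [AddCommGroup D] [Module K D] {S : Dialgebra K D}
  {C : Type w} [CommRing C] [Algebra K C] {ε : C →ₐ[K] K} (η : Deformation S C ε)
  (μ : HarrH2 ε →ₗ[K] harrZ2 ε K)

/-- The coordinate of `C_{k+1}` on `(ker ω_k)'`: the restriction to `ker ω_k` of the second
component of a representative in `C̄_{k+1} = C_k ⊕ H^2_Harr(C_k; K)'`. -/
def nextCoord : NextBase η μ →ₗ[K] Module.Dual K (LinearMap.ker (obstruction η)) :=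
  ((obstrIdeal η μ).restrictScalars K).liftQ
    ((LinearMap.ker (obstruction η)).subtype.dualMap ∘ₗ HarrExt.fibMap (univCocycle μ))
    (by
      rintro _ ⟨χ, rfl⟩
      refine LinearMap.ext fun α => ?_
      exact (congrArg χ α.2).trans χ.map_zero) ∘ₗ
  (Submodule.Quotient.restrictScalarsEquiv K (obstrIdeal η μ)).symm.toLinearMap

theorem nextCoord_mk (x : HarrExt (univCocycle μ)) :
    nextCoord η μ (Ideal.Quotient.mk _ x) = x.fib ∘ₗ (LinearMap.ker (obstruction η)).subtype := rfl

theorem nextProj_mk (x : HarrExt (univCocycle μ)) :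
    nextProj η μ (Ideal.Quotient.mk _ x) = x.base := rfl

theorem mk_mul_mk_incl (x : HarrExt (univCocycle μ)) (ψ : Module.Dual K (HarrH2 ε)) :
    Ideal.Quotient.mk (obstrIdeal η μ) x *
        Ideal.Quotient.mk (obstrIdeal η μ) (HarrExt.incl (univCocycle μ) ψ) =
      ε x.base • Ideal.Quotient.mk (obstrIdeal η μ) (HarrExt.incl (univCocycle μ) ψ) := by
  refine (map_mul (Ideal.Quotient.mk (obstrIdeal η μ)) _ _).symm.trans ?_
  rw [HarrExt.mul_incl, map_smul (HarrExt.incl _)]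
  rfl

theorem mul_nextIncl (b : NextBase η μ) (ξ : Module.Dual K (LinearMap.ker (obstruction η))) :
    b * nextIncl η μ ξ = ε (nextProj η μ b) • nextIncl η μ ξ := by
  obtain ⟨x, rfl⟩ := Ideal.Quotient.mk_surjective b
  obtain ⟨ψ, rfl⟩ := ξ.exists_extend
  rw [nextIncl_restrict, nextProj_mk]
  exact mk_mul_mk_incl η μ x ψ

/-- `C_{k+1}` as a small extension of `C_k`. -/
def nextExtension :
    SmallExtension (nextProj η μ) ε (LinearMap.ker (obstruction η)) where
  incl := nextIncl η μ
  split := (Ideal.Quotient.mkₐ K (obstrIdeal η μ)).toLinearMap ∘ₗ HarrExt.split (univCocycle μ)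
  coord := nextCoord η μ
  cocycle := μ ∘ₗ (LinearMap.ker (obstruction η)).subtype
  proj_split _ := rfl
  coord_incl ξ := by
    obtain ⟨ψ, rfl⟩ := ξ.exists_extend
    rw [nextIncl_restrict, nextCoord_mk]
    rfl
  split_add_incl b := by
    obtain ⟨x, rfl⟩ := Ideal.Quotient.mk_surjective b
    rw [nextCoord_mk, nextIncl_restrict, nextProj_mk]
    refine (map_add (Ideal.Quotient.mk (obstrIdeal η μ)) _ _).symm.trans (congrArg _ ?_)
    exact HarrExt.ext (add_zero _) (zero_add _)
  mul_incl := mul_nextIncl η μ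
  coord_mul a a' α := by
    refine (congrArg (nextCoord η μ · α)
      (map_mul (Ideal.Quotient.mk (obstrIdeal η μ)) _ _).symm).trans ?_
    rw [nextCoord_mk]
    simp [univCocycle_apply]

end Next

section HarrExtensions

variable {K A V : Type*} [Field K] [CommRing A] [Algebra K A] {ε : A →ₐ[K] K} [AddCommGroup V]
  [Module K V] (f : harrZ2 ε V)

instance HarrExt.finiteDimensional [FiniteDimensional K A] [FiniteDimensional K V] :
    FiniteDimensional K (HarrExt f) :=
  Module.Finite.of_surjective ((HarrExt.split f).coprod (HarrExt.incl f)) fun x =>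
    ⟨(x.base, x.fib), HarrExt.ext (add_zero _) (zero_add _)⟩

theorem HarrExt.isLocalRing [IsLocalRing A] : IsLocalRing (HarrExt f) :=
  isLocalRing_of_surjective_of_ker_sq_eq_zero (HarrExt.proj f).toRingHom
    (fun a => ⟨HarrExt.split f a, rfl⟩) fun x hx => by
      rw [show x = HarrExt.incl f x.fib from HarrExt.ext hx rfl, HarrExt.incl_mul_incl]

end HarrExtensions

/-! ### The stages of the construction -/

section Stages

variable {K : Type u} {D : Type v} [Field K] [AddCommGroup D] [Module K D] {S : Dialgebra K D}
  [FiniteDimensional K (HY2 S)]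

theorem defCochain_universalInfinitesimal (μ : HY2 S →ₗ[K] ZY2 S) (α : HY2 S) :
    defCochain (universalInfinitesimal μ) ((HarrExt.fibMap (infCocycle S)).flip α) = (μ α).1 := by
  funext y
  refine LinearMap.ext₂ fun a b => ?_
  have fib_one : HarrExt.fibMap (infCocycle S) 1 = 0 := neg_zero
  rw [defCochain_apply, universalInfinitesimal, sqZeroDeformation_op, sqZeroOp_one, map_add,
    contract_tmul, LinearMap.flip_apply, fib_one, LinearMap.zero_apply, zero_smul, zero_add,
    ← contractHom_apply, contractHom_homIncl _ _ fun _ => rfl, evalCocycle_apply,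
    sideTree_prodSide]

theorem differential_universalInfinitesimal_surjective {μ : HY2 S →ₗ[K] ZY2 S}
    (hμ : ∀ α, HY2.mk S (μ α) = α) :
    Function.Surjective (differential (universalInfinitesimal μ)) := fun α => by
  have hder : (HarrExt.fibMap (infCocycle S)).flip α ∈ harrZ1 (infAug S) K :=
    mem_harrZ1.2 fun a b => LinearMap.congr_fun (add_zero (a.base • b.fib + b.base • a.fib)) α
  refine ⟨⟨_, hder⟩, ?_⟩
  rw [differential_apply]
  refine Eq.trans ?_ (hμ α)
  congr 1
  exact Subtype.ext (defCochain_universalInfinitesimal μ α)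

variable {k : ℕ} {C : Type (max u v)} [CommRing C] [Algebra K C] {ε : C →ₐ[K] K}
  {η : Deformation S C ε}

theorem IsStage.finiteDimensional_and_isLocalRing (hη : IsStage S k C ε η) :
    FiniteDimensional K C ∧ IsLocalRing C := by
  induction hη with
  | one => exact ⟨inferInstance, HarrExt.isLocalRing _⟩
  | succ _ μ _ _ _ ih =>
    obtain ⟨_, _⟩ := ih
    exact ⟨(nextExtension _ μ).finiteDimensional, (nextExtension _ μ).isLocalRing⟩

theorem IsStage.differential_surjective (hη : IsStage S k C ε η) :
    Function.Surjective (differential η) := by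
  induction hη with
  | one _ hμ => exact differential_universalInfinitesimal_surjective hμ
  | succ _ _ _ _ hη' ih => exact differential_surjective_of_pushout _ _ (hη'.symm ▸ ih)

end Stages

end DialgDef

end

theorem mainTheorem9_general {K : Type u} {D : Type v} [Field K] [AddCommGroup D] [Module K D]
    {S : Dialgebra K D} {C : Type w} [CommRing C] [Algebra K C] [FiniteDimensional K C]
    [IsLocalRing C] {ε : C →ₐ[K] K} (η : Deformation S C ε)
    (hη : Function.Surjective (differential η))
    (μ : HarrH2 ε →ₗ[K] harrZ2 ε K) (hμ : ∀ α, HarrH2.mk ε (μ α) = α) :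
    (FiniteDimensional K (NextBase η μ) ∧ IsLocalRing (NextBase η μ)) ∧
    (Function.Injective (nextIncl η μ) ∧ Function.Exact (nextIncl η μ) (nextProj η μ) ∧
      Function.Surjective (nextProj η μ)) ∧
    (∃ η' : Deformation S (NextBase η μ) (nextAug η μ),
      η'.pushout (nextProj η μ) (fun _ => rfl) = η) ∧
    (∀ η' η'' : Deformation S (NextBase η μ) (nextAug η μ),
      η'.pushout (nextProj η μ) (fun _ => rfl) = η →
      η''.pushout (nextProj η μ) (fun _ => rfl) = η →
      ∃ (r : NextBase η μ ≃ₐ[K] NextBase η μ) (hr : ∀ c, nextProj η μ (r c) = nextProj η μ c),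
        (∀ ψ, r (nextIncl η μ ψ) = nextIncl η μ ψ) ∧
        (η'.pushout r.toAlgHom
          (fun c => congrArg ε (hr c))).Equivalent η'') := by
  let X := nextExtension η μ
  have unobstructed (α : LinearMap.ker (obstruction η)) :
      obstruction η (HarrH2.mk ε (X.cocycle α)) = 0 :=
    (congrArg (obstruction η) (hμ α)).trans α.2
  exact ⟨⟨X.finiteDimensional, X.isLocalRing⟩,
    ⟨X.incl_injective, X.exact, X.proj_surjective⟩,
    X.exists_pushout_eq η unobstructed,
    fun η' η'' h' h'' => X.exists_aut_equivalent hη h' h''⟩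

theorem mainTheorem9 {K : Type u} {D : Type v} [Field K] [CharZero K] [AddCommGroup D] [Module K D]
    (S : Dialgebra K D) [FiniteDimensional K (HY2 S)]
    (k : ℕ) (C : Type (max u v)) [CommRing C] [Algebra K C] (ε : C →ₐ[K] K)
    (η : Deformation S C ε) (hη : IsStage S k C ε η)
    (μ : HarrH2 ε →ₗ[K] harrZ2 ε K) (hμ : ∀ α, HarrH2.mk ε (μ α) = α) :
    (FiniteDimensional K (NextBase η μ) ∧ IsLocalRing (NextBase η μ)) ∧
    (Function.Injective (nextIncl η μ) ∧ Function.Exact (nextIncl η μ) (nextProj η μ) ∧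
      Function.Surjective (nextProj η μ)) ∧
    (∃ η' : Deformation S (NextBase η μ) (nextAug η μ),
      η'.pushout (nextProj η μ) (fun _ => rfl) = η) ∧
    (∀ η' η'' : Deformation S (NextBase η μ) (nextAug η μ),
      η'.pushout (nextProj η μ) (fun _ => rfl) = η →
      η''.pushout (nextProj η μ) (fun _ => rfl) = η →
      ∃ (r : NextBase η μ ≃ₐ[K] NextBase η μ) (hr : ∀ c, nextProj η μ (r c) = nextProj η μ c),
        (∀ ψ, r (nextIncl η μ ψ) = nextIncl η μ ψ) ∧
        (η'.pushout r.toAlgHom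
          (fun c => congrArg ε (hr c))).Equivalent η'') := by
  obtain ⟨_, _⟩ := hη.finiteDimensional_and_isLocalRing
  exact mainTheorem9_general η hη.differential_surjective μ hμ
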